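/- Let $d,k,l\in\mathbf N$, let $\Omega\subset\mathbf R^d$ be measurable (for instance a domain) with interior $\Omega^{\rm int}$, and let $p(\nabla)=\sum_{j=1}^d p_j\,\partial/\partial x_j$ with symmetric constant matrices $p_j\in\mathbf R^{k\times k}$. Let $P$ be a skew-adjoint operator on $L^2(\Omega)^k$ with dense domain $V$ which extends $p(\nabla)$ on $C_0^\infty(\Omega^{\rm int})^k$, and give $V$ the graph norm of $P$. Let $\Gamma\subset\Omega$ be a smoothly embedded $n$-dimensional submanifold of $\mathbf R^d$, $n<d$, let $m\in C_0^\infty(\Gamma,\mathbf R^{l\times k})$, and for $\phi\in C_0^\infty(\Omega^{\rm int})^k$ put $S[m]\phi=m\,\phi|_\Gamma\in L^2(\Gamma)^l$. Let $M$ be the set of all triples $(a,b,q)$ in the Banach space $$L^\infty(\Omega,\mathbf R^{k\times k}_{\rm symm})\times L^\infty(\Omega,\mathbf R^{k\times k})\times L^1(\mathbf R_+,L^\infty(\Omega,\mathbf R^{k\times k}_{\rm symm}))$$ for which there are constants $0<C_*\le C^*$ and $C_B,C_Q>0$ such that $C_*I<a(\mathbf x)<C^*I$ for almost every $\mathbf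 x\in\Omega$, $\|b\|<C_B$ and $\|q\|<C_Q$; $q$ is extended by $q(t)=0$ for $t<0$. Suppose that (i) $S[m]$ extends to a continuous linear map $S[m]:V\to L^2(\Gamma)^l$ (fix such an extension), and (ii) $s\ge 2$ is an integer and $f\in H^s(\mathbf R,L^2(\Omega)^k)$ is causal, i.e. $f(t)=0$ for $t<0$. Then for every $T>0$: (1) for every $(a,b,q)\in M$ there is exactly one $u\in C^1(\mathbf R,L^2(\Omega)^k)\cap C^0(\mathbf R,V)$ with $u(t)=0$ for $t<0$ and $$a\,\frac{\partial u}{\partial t}+p(\nabla)u+bu+q*u=f\quad\text{a.e. in }\Omega\text{ for each }t\in\mathbf R,$$ where $p(\nabla)u$ means $Pu$, $(q*u)(t)=\int_0^\infty q(\tau)u(t-\tau)\,d\tau$ and $f$ is identified with its continuous representative; hence $\mathcal F_{f,m}(a,b,q)=S[m]u|_{[0,T]}$ is well defined as an element of $C^0([0,T],L^2(\Gamma)^l)$; (2) the map $\mathcal F_{f,m}:M\to C^0([0,T],L^2(\Gamma)^l)$ is of class $C^{s-1}$ with respect to the norm of the Banach space above. -/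

import Mathlib

open MeasureTheory Set
open scoped ENNReal ContDiff Matrix Matrix.Norms.L2Operator

noncomputable section

namespace SymmHyp

/-! ### Abstract notions: skew-adjoint operators, graph norm, Sobolev regularity in time -/

section Abstract

variable {H : Type*} [NormedAddCommGroup H] [InnerProductSpace ℝ H]

/-- `P` is a densely defined operator with `P† = -P` (equality of unbounded operators,
including their domains). -/
def IsSkewAdjoint [CompleteSpace H] (P : H →ₗ.[ℝ] H) : Prop :=
  Dense (P.domain : Set H) ∧ P.adjoint = -P

/-- The domain `V` of the operator `P`, metrized by the graph norm. -/
def GraphSpace (P : H →ₗ.[ℝ] H) : Type _ := P.domain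

namespace GraphSpace

variable (P : H →ₗ.[ℝ] H)

instance : AddCommGroup (GraphSpace P) := inferInstanceAs (AddCommGroup P.domain)

instance : Module ℝ (GraphSpace P) := inferInstanceAs (Module ℝ P.domain)

/-- The inclusion of `V` in `H`. -/
def incl : GraphSpace P →ₗ[ℝ] H := P.domain.subtype

/-- The operator `P` as a map from `V` to `H`. -/
def op : GraphSpace P →ₗ[ℝ] H := P.toFun

/-- The map `v ↦ (v, P v)` into the Hilbert space `H × H`. -/
def toGraph : GraphSpace P →ₗ[ℝ] WithLp 2 (H × H) :=
  (WithLp.linearEquiv 2 ℝ (H × H)).symm.toLinearMap ∘ₗ (incl P).prod (op P)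

theorem toGraph_injective : Function.Injective (toGraph P) := by
  intro v w h
  have h' : (incl P v, op P v) = (incl P w, op P w) :=
    (WithLp.linearEquiv 2 ℝ (H × H)).symm.injective h
  exact Subtype.ext (congrArg Prod.fst h')

instance : NormedAddCommGroup (GraphSpace P) :=
  NormedAddCommGroup.induced (GraphSpace P) (WithLp 2 (H × H)) (toGraph P) (toGraph_injective P)

instance : NormedSpace ℝ (GraphSpace P) :=
  NormedSpace.induced ℝ (GraphSpace P) (WithLp 2 (H × H)) (toGraph P)

/-- The norm of `V` is the graph norm. -/
theorem norm_sq_eq (v : GraphSpace P) : ‖v‖ ^ 2 = ‖incl P v‖ ^ 2 + ‖op P v‖ ^ 2 :=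
  WithLp.prod_norm_sq_eq_of_L2 (toGraph P v)

end GraphSpace

/-- `g` is the weak derivative of `f : ℝ → H`. -/
def IsWeakDeriv (f g : ℝ → H) : Prop :=
  ∀ φ : ℝ → ℝ, ContDiff ℝ ∞ φ → HasCompactSupport φ →
    ∫ t, deriv φ t • f t = - ∫ t, φ t • g t

/-- `f ∈ H^s(ℝ, H)`: the weak derivatives of `f` of orders `0, …, s` exist and lie in
`L²(ℝ, H)`. -/
def MemHs (s : ℕ) (f : ℝ → H) : Prop :=
  ∃ D : ℕ → ℝ → H, D 0 = f ∧ (∀ j ≤ s, MemLp (D j) 2 volume) ∧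
    ∀ j < s, IsWeakDeriv (D j) (D (j + 1))

end Abstract

/-! ### Function spaces over `Ω` -/

/-- Real `k × k` matrices (with the operator norm). -/
abbrev Mat (k : ℕ) : Type := Matrix (Fin k) (Fin k) ℝ

/-- Symmetric real `k × k` matrices. -/
def symmMat (k : ℕ) : Submodule ℝ (Mat k) where
  carrier := {A | A.IsSymm}
  add_mem' hA hB := hA.add hB
  zero_mem' := Matrix.isSymm_zero
  smul_mem' c _ hA := hA.smul c

/-- Lebesgue measure on `Ω ⊆ ℝ^d`. -/
abbrev vol {d : ℕ} (Ω : Set (EuclideanSpace ℝ (Fin d))) : Measure (EuclideanSpace ℝ (Fin d)) :=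
  volume.restrict Ω

/-- The state space `H = L²(Ω)^k`. -/
abbrev State {d : ℕ} (Ω : Set (EuclideanSpace ℝ (Fin d))) (k : ℕ) : Type :=
  Lp (EuclideanSpace ℝ (Fin k)) 2 (vol Ω)

/-- `L^∞(Ω, ℝ^{k×k})`. -/
abbrev LInfMat {d : ℕ} (Ω : Set (EuclideanSpace ℝ (Fin d))) (k : ℕ) : Type :=
  Lp (Mat k) ∞ (vol Ω)

/-- `L^∞(Ω, ℝ^{k×k}_symm)`. -/
abbrev LInfSymm {d : ℕ} (Ω : Set (EuclideanSpace ℝ (Fin d))) (k : ℕ) : Type :=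
  Lp (symmMat k) ∞ (vol Ω)

/-- The Banach space `L^∞(Ω, ℝ^{k×k}_symm) × L^∞(Ω, ℝ^{k×k}) × L¹(ℝ₊, L^∞(Ω, ℝ^{k×k}_symm))`
of triples `(a, b, q)`. The kernel `q` is extended by zero to `t < 0`. -/
abbrev Coeff {d : ℕ} (Ω : Set (EuclideanSpace ℝ (Fin d))) (k : ℕ) : Type :=
  LInfSymm Ω k × LInfMat Ω k × Lp (LInfSymm Ω k) 1 (volume.restrict (Ici (0 : ℝ)))

/-- The set `M(C_*, C^*, C_B, C_Q)`; here `c = C_*` and `C = C^*`, and the strict inequalities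
between symmetric matrices mean that the difference is positive definite. -/
def admissibleWith {d : ℕ} (Ω : Set (EuclideanSpace ℝ (Fin d))) (k : ℕ) (c C CB CQ : ℝ) :
    Set (Coeff Ω k) :=
  {w | (∀ᵐ x ∂(vol Ω), ((w.1 x : Mat k) - c • (1 : Mat k)).PosDef ∧
        (C • (1 : Mat k) - (w.1 x : Mat k)).PosDef) ∧
      ‖w.2.1‖ < CB ∧ ‖w.2.2‖ < CQ}

/-- The set `M` of admissible coefficients. -/
def admissible {d : ℕ} (Ω : Set (EuclideanSpace ℝ (Fin d))) (k : ℕ) : Set (Coeff Ω k) :=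
  {w | ∃ c C CB CQ : ℝ, 0 < c ∧ c ≤ C ∧ 0 < CB ∧ 0 < CQ ∧ w ∈ admissibleWith Ω k c C CB CQ}

/-- The action of matrices on vectors, as a continuous bilinear map. -/
def matAct (k : ℕ) : Mat k →L[ℝ] EuclideanSpace ℝ (Fin k) →L[ℝ] EuclideanSpace ℝ (Fin k) :=
  LinearMap.toContinuousLinearMap
    (Matrix.toEuclideanCLM (n := Fin k) (𝕜 := ℝ)).toAlgEquiv.toLinearMap

theorem matAct_apply {k : ℕ} (A : Mat k) (v : EuclideanSpace ℝ (Fin k)) :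
    matAct k A v = WithLp.toLp 2 (A *ᵥ v.ofLp) := rfl

/-- Multiplication of `u ∈ L²(Ω)^k` by `b ∈ L^∞(Ω, ℝ^{k×k})`. -/
def mulOp {d k : ℕ} {Ω : Set (EuclideanSpace ℝ (Fin d))} (b : LInfMat Ω k) (u : State Ω k) :
    State Ω k :=
  (matAct k).holder 2 b u

theorem coeFn_mulOp {d k : ℕ} {Ω : Set (EuclideanSpace ℝ (Fin d))} (b : LInfMat Ω k)
    (u : State Ω k) :
    mulOp b u =ᵐ[vol Ω] fun x => WithLp.toLp 2 (b x *ᵥ (u x).ofLp) :=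
  (matAct k).coeFn_holder b u

/-- Multiplication of `u ∈ L²(Ω)^k` by `a ∈ L^∞(Ω, ℝ^{k×k}_symm)`. -/
def mulOpSymm {d k : ℕ} {Ω : Set (EuclideanSpace ℝ (Fin d))} (a : LInfSymm Ω k)
    (u : State Ω k) : State Ω k :=
  ((matAct k).comp (symmMat k).subtypeL).holder 2 a u

theorem coeFn_mulOpSymm {d k : ℕ} {Ω : Set (EuclideanSpace ℝ (Fin d))} (a : LInfSymm Ω k)
    (u : State Ω k) :
    mulOpSymm a u =ᵐ[vol Ω] fun x => WithLp.toLp 2 ((a x : Mat k) *ᵥ (u x).ofLp) :=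
  ((matAct k).comp (symmMat k).subtypeL).coeFn_holder a u

/-! ### The differential operator `p(∇)` -/

/-- `φ ∈ C₀^∞(Ω^int)^k`. -/
def IsTest {d k : ℕ} (Ω : Set (EuclideanSpace ℝ (Fin d)))
    (φ : EuclideanSpace ℝ (Fin d) → EuclideanSpace ℝ (Fin k)) : Prop :=
  ContDiff ℝ ∞ φ ∧ HasCompactSupport φ ∧ tsupport φ ⊆ interior Ω

/-- `p(∇) φ = ∑_j p_j ∂φ/∂x_j`. -/
def pGrad {d k : ℕ} (p : Fin d → Mat k)
    (φ : EuclideanSpace ℝ (Fin d) → EuclideanSpace ℝ (Fin k)) (x : EuclideanSpace ℝ (Fin d)) :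
    EuclideanSpace ℝ (Fin k) :=
  ∑ j, WithLp.toLp 2 (p j *ᵥ (fderiv ℝ φ x (EuclideanSpace.single j 1)).ofLp)

/-- The operator `P` on `L²(Ω)^k` extends `p(∇)` on `C₀^∞(Ω^int)^k`. -/
def Extends {d k : ℕ} {Ω : Set (EuclideanSpace ℝ (Fin d))} (P : State Ω k →ₗ.[ℝ] State Ω k)
    (p : Fin d → Mat k) : Prop :=
  ∀ φ : EuclideanSpace ℝ (Fin d) → EuclideanSpace ℝ (Fin k), IsTest Ω φ →
    ∃ v : P.domain, (v : State Ω k) =ᵐ[vol Ω] φ ∧ P v =ᵐ[vol Ω] pGrad p φ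

/-! ### Submanifolds and the map `S[m]` -/

/-- `Γ ⊆ ℝ^d` is a smoothly embedded `n`-dimensional submanifold: near each of its points it is
the preimage of the coordinate plane `{y | y_i = 0 for i ≥ n}` under a smooth diffeomorphism
between open sets. -/
def IsSmoothSubmanifold {d : ℕ} (n : ℕ) (Γ : Set (EuclideanSpace ℝ (Fin d))) : Prop :=
  ∀ x ∈ Γ, ∃ Φ : OpenPartialHomeomorph (EuclideanSpace ℝ (Fin d)) (EuclideanSpace ℝ (Fin d)),
    x ∈ Φ.source ∧ ContDiffOn ℝ ∞ Φ Φ.source ∧ ContDiffOn ℝ ∞ Φ.symm Φ.target ∧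
    ∀ y ∈ Φ.source, y ∈ Γ ↔ ∀ i : Fin d, n ≤ (i : ℕ) → Φ y i = 0

/-- The `n`-dimensional surface measure on `Γ`. -/
abbrev surf {d : ℕ} (n : ℕ) (Γ : Set (EuclideanSpace ℝ (Fin d))) :
    Measure (EuclideanSpace ℝ (Fin d)) :=
  (Measure.euclideanHausdorffMeasure n).restrict Γ

/-- The data space `L²(Γ)^l`. -/
abbrev Data {d : ℕ} (n : ℕ) (Γ : Set (EuclideanSpace ℝ (Fin d))) (l : ℕ) : Type :=
  Lp (EuclideanSpace ℝ (Fin l)) 2 (surf n Γ)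

/-- `m ∈ C₀^∞(Γ, ℝ^{l×k})`; only the values of `m` on `Γ` matter. -/
def IsMultiplier {d k l : ℕ} (Γ : Set (EuclideanSpace ℝ (Fin d)))
    (m : EuclideanSpace ℝ (Fin d) → Matrix (Fin l) (Fin k) ℝ) : Prop :=
  (∀ i j, ContDiffOn ℝ ∞ (fun x => m x i j) Γ) ∧
    ∃ K ⊆ Γ, IsCompact K ∧ ∀ x ∈ Γ \ K, m x = 0

/-- The continuous linear map `S : V → L²(Γ)^l` extends `S[m]`, that is, `S φ` is the restriction
of `m φ` to `Γ` for every `φ ∈ C₀^∞(Ω^int)^k`. -/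
def ExtendsTrace {d k l n : ℕ} {Ω Γ : Set (EuclideanSpace ℝ (Fin d))}
    {P : State Ω k →ₗ.[ℝ] State Ω k}
    (m : EuclideanSpace ℝ (Fin d) → Matrix (Fin l) (Fin k) ℝ)
    (S : GraphSpace P →L[ℝ] Data n Γ l) : Prop :=
  ∀ φ : EuclideanSpace ℝ (Fin d) → EuclideanSpace ℝ (Fin k), IsTest Ω φ →
    ∀ v : GraphSpace P, GraphSpace.incl P v =ᵐ[vol Ω] φ →
      S v =ᵐ[surf n Γ] fun x => WithLp.toLp 2 (m x *ᵥ (φ x).ofLp)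

/-! ### Causal solutions and the forward map -/

/-- `u ∈ C¹(ℝ, L²(Ω)^k) ∩ C⁰(ℝ, V)` vanishes for `t < 0` and satisfies
`a u' + p(∇) u + b u + q * u = f` a.e. in `Ω` for each `t`, where `f` is identified with its
continuous representative. (For such `u` the convolution integral converges absolutely
in `L²(Ω)^k`.) -/
def IsCausalSolution {d k : ℕ} {Ω : Set (EuclideanSpace ℝ (Fin d))}
    (P : State Ω k →ₗ.[ℝ] State Ω k) (f : ℝ → State Ω k) (w : Coeff Ω k)
    (u : ℝ → GraphSpace P) : Prop :=
  Continuous u ∧ ContDiff ℝ 1 (fun t => GraphSpace.incl P (u t)) ∧ (∀ t < 0, u t = 0) ∧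
    ∃ g : ℝ → State Ω k, Continuous g ∧ g =ᵐ[volume] f ∧
      ∀ t, mulOpSymm w.1 (deriv (fun τ => GraphSpace.incl P (u τ)) t) + GraphSpace.op P (u t) +
        mulOp w.2.1 (GraphSpace.incl P (u t)) +
        ∫ τ in Ici (0 : ℝ), mulOpSymm (w.2.2 τ) (GraphSpace.incl P (u (t - τ))) = g t

open Classical in
/-- The forward map `(a, b, q) ↦ S u` with values in `C⁰([0, T], L²(Γ)^l)`, where `u` is the causal
solution with coefficients `(a, b, q)` (and the value is `0` if there is none). -/
def forwardMap {d k l n : ℕ} {Ω Γ : Set (EuclideanSpace ℝ (Fin d))}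
    (P : State Ω k →ₗ.[ℝ] State Ω k) (S : GraphSpace P →L[ℝ] Data n Γ l) (f : ℝ → State Ω k)
    (T : ℝ) (w : Coeff Ω k) : C(Icc (0 : ℝ) T, Data n Γ l) :=
  if h : ∃ u, IsCausalSolution P f w u then
    ⟨fun t => S (h.choose t), S.continuous.comp (h.choose_spec.1.comp continuous_subtype_val)⟩
  else 0

end SymmHyp

end

noncomputable section

namespace SymmHyp

universe u

open Filter Topology
open scoped BoundedContinuousFunction RealInnerProductSpace

/-! ### Families with a resolvent identity that loses one integration -/

section LossyCalculus

variable {W X : Type u} [NormedAddCommGroup W] [NormedSpace ℝ W]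
  [NormedAddCommGroup X] [NormedSpace ℝ X]

/-! Since `a` multiplies the time derivative of `u`, differentiating the solution in the
coefficients costs one time derivative of the data. The proof turns this loss into an algebraic
identity. Let `I` be integration in time from 0 (`integ`) and let `B w` send data to the causal
solution with coefficients `w`; as `B w` commutes with `I`, it also gives the time derivative of the
solution for the integrated data. Subtracting the equations for `w` and `w'` and using uniqueness
gives `I (B w' - B w) = -B w' E(w' - w) B w`, with `E` bounded and linear in the coefficients
(`resolvent_identity`, `fullOp`).

With locally uniform bounds on `B` and density of the range of `I`, this identity makes `B` strongly
continuous and then makes `I (B w g)` differentiable in `w`, with derivative `-B w E(·) B w g`. The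
pair formed by `B w g` and `B w E(·) B w g` satisfies an identity of the same shape on a larger
space (`LossyFamily.tangent`), so induction shows that `j` integrations buy class C^j
(`LossyFamily.contDiffOn`).

The operators `B w` come from Yosida approximation of the skew-adjoint operator and an energy
estimate (`exists_solutionOperator`), followed by a Volterra perturbation for `b` and `q`. All
bounds involve only the L¹ norm of the data in time. This matters for the count of derivatives: a
causal `f` in H^s is an `s`-fold primitive of a locally integrable `g` (`MemHs.exists_prim`), and `v
w`, formally `B w g`, exists as a limit over continuous data although `g` need not be continuous
(`exists_lossyFamily`). Then `u' = I^(s-1) v` is of class C^(s-1); starting from the continuous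
primitive of `g` this argument would give one order less.

The map `S` acts only on `V`. The equation expresses `P u` through `u'` and `u`, hence `u = (1 +
P)⁻¹ (u + P u)` depends on the coefficients as smoothly as `u'` does, now with values in `V`. -/

/-- A family `B` of operators that satisfies a resolvent identity up to the operator `I`, together
with a family `v` of vectors on which it acts like `B w g` with a fixed `g`. -/
structure LossyFamily (M : Set W) (I : X →L[ℝ] X) (E : W →L[ℝ] X →L[ℝ] X) (B : W → X →L[ℝ] X)
    (v : W → X) : Prop where
  comm_B : ∀ w ∈ M, ∀ x, I (B w x) = B w (I x)
  comm_E : ∀ w x, I (E w x) = E w (I x)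
  bdd : ∀ w ∈ M, ∃ C, ∀ᶠ w' in 𝓝 w, ‖B w'‖ ≤ C
  resolvent : ∀ w ∈ M, ∀ w' ∈ M, ∀ x, I (B w' x - B w x) = -B w' (E (w' - w) (B w x))
  cont : ContinuousOn v M
  mem : ∀ w ∈ M, v w ∈ closure (range I)
  resolvent_vec : ∀ w ∈ M, ∀ w' ∈ M, I (v w' - v w) = -B w' (E (w' - w) (v w))

/-- Strong continuity of `B` on the closure of the range of `I`. -/
theorem tendsto_apply_of_resolvent {M : Set W} (hM : IsOpen M) {I : X →L[ℝ] X}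
    {E : W →L[ℝ] X →L[ℝ] X} {B : W → X →L[ℝ] X}
    (comm_B : ∀ w ∈ M, ∀ x, I (B w x) = B w (I x))
    (bdd : ∀ w ∈ M, ∃ C, ∀ᶠ w' in 𝓝 w, ‖B w'‖ ≤ C)
    (resolvent : ∀ w ∈ M, ∀ w' ∈ M, ∀ x, I (B w' x - B w x) = -B w' (E (w' - w) (B w x)))
    {w : W} (hw : w ∈ M) {x : X} (hx : x ∈ closure (range I)) :
    Tendsto (fun w' => B w' x) (𝓝 w) (𝓝 (B w x)) := by
  obtain ⟨C, hC⟩ := bdd w hw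
  have hC0 : 0 ≤ C := (norm_nonneg _).trans hC.self_of_nhds
  rw [Metric.tendsto_nhds]
  intro ε hε
  obtain ⟨_, ⟨y, rfl⟩, hy⟩ := Metric.mem_closure_iff.1 hx (ε / (4 * (C + 1))) (by positivity)
  have hlim : Tendsto (fun w' => C * (‖E‖ * ‖w' - w‖ * ‖B w y‖)) (𝓝 w) (𝓝 0) := by
    have : Continuous (fun w' => C * (‖E‖ * ‖w' - w‖ * ‖B w y‖)) := by fun_prop
    simpa using this.tendsto w
  filter_upwards [hC, hM.mem_nhds hw, hlim.eventually (gt_mem_nhds (half_pos hε))] with w' h1 h2 h3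
  have e1 : B w' (I y) - B w (I y) = -B w' (E (w' - w) (B w y)) := by
    rw [← resolvent w hw w' h2, map_sub, comm_B w' h2, comm_B w hw]
  have e2 : B w' x - B w x = B w' (x - I y) - B w (x - I y) + (B w' (I y) - B w (I y)) := by
    simp only [map_sub]; abel
  rw [dist_eq_norm, e2, e1]
  rw [dist_eq_norm] at hy
  have hb : ∀ w', ‖B w'‖ ≤ C → ‖B w' (x - I y)‖ ≤ ε / 4 := fun w' h => by
    calc ‖B w' (x - I y)‖ ≤ C * ‖x - I y‖ := (B w').le_of_opNorm_le h _
      _ ≤ (C + 1) * (ε / (4 * (C + 1))) := by gcongr; linarith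
      _ = ε / 4 := by field_simp
  have h4 : ‖B w' (E (w' - w) (B w y))‖ ≤ C * (‖E‖ * ‖w' - w‖ * ‖B w y‖) := by
    refine ((B w').le_of_opNorm_le h1 _).trans ?_
    gcongr
    exact E.le_opNorm₂ _ _
  calc _ ≤ ‖B w' (x - I y)‖ + ‖B w (x - I y)‖ + ‖-B w' (E (w' - w) (B w y))‖ :=
        (norm_add_le _ _).trans (by gcongr; exact norm_sub_le _ _)
    _ < ε / 4 + ε / 4 + ε / 2 := by
        rw [norm_neg]
        have := hb w' h1
        have := hb w hC.self_of_nhds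
        linarith
    _ = ε := by ring

omit [NormedSpace ℝ W] in
/-- Joint continuity of the action of `B` on the closure of the range of `I`. -/
theorem tendsto_apply_apply {B : W → X →L[ℝ] X} {w : W} {C : ℝ} (hC : ∀ᶠ w' in 𝓝 w, ‖B w'‖ ≤ C)
    {v : W → X} {s : Set W} (hv : ContinuousWithinAt v s w)
    (hB : Tendsto (fun w' => B w' (v w)) (𝓝 w) (𝓝 (B w (v w)))) :
    ContinuousWithinAt (fun w' => B w' (v w')) s w := by
  have h1 : Tendsto (fun w' => B w' (v w' - v w)) (𝓝[s] w) (𝓝 0) := by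
    have h2 : Tendsto (fun w' => C * ‖v w' - v w‖) (𝓝[s] w) (𝓝 0) := by
      have h3 : Tendsto (fun w' => v w' - v w) (𝓝[s] w) (𝓝 (v w - v w)) :=
        Tendsto.sub hv tendsto_const_nhds
      simpa using h3.norm.const_mul C
    refine squeeze_zero_norm' ?_ h2
    filter_upwards [nhdsWithin_le_nhds hC] with w' h using (B w').le_of_opNorm_le h _
  have h2 := h1.add (hB.mono_left (nhdsWithin_le_nhds (s := s)))
  simpa [ContinuousWithinAt] using h2

/-- The operator `(x, y) ↦ (B x, B y + B E(·) B x)` on `X × (W →L X)`. -/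
def tangentOp (E : W →L[ℝ] X →L[ℝ] X) (b : X →L[ℝ] X) :
    (X × (W →L[ℝ] X)) →L[ℝ] (X × (W →L[ℝ] X)) :=
  (b ∘L ContinuousLinearMap.fst ℝ X (W →L[ℝ] X)).prod
    (ContinuousLinearMap.compL ℝ W X X b ∘L
      (ContinuousLinearMap.snd ℝ X (W →L[ℝ] X) +
        E.flip ∘L b ∘L ContinuousLinearMap.fst ℝ X (W →L[ℝ] X)))

/-- The diagonal action of `e` on `X × (W →L X)`. -/
def diagOp : (X →L[ℝ] X) →L[ℝ] (X × (W →L[ℝ] X)) →L[ℝ] (X × (W →L[ℝ] X)) :=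
  ContinuousLinearMap.prodMapL ℝ X X (W →L[ℝ] X) (W →L[ℝ] X) ∘L
    (ContinuousLinearMap.id ℝ _).prod (ContinuousLinearMap.compL ℝ W X X)

@[simp] theorem tangentOp_apply (E : W →L[ℝ] X →L[ℝ] X) (b : X →L[ℝ] X) (z : X × (W →L[ℝ] X)) :
    tangentOp E b z = (b z.1, b ∘L (z.2 + E.flip (b z.1))) := rfl

@[simp] theorem diagOp_apply (e : X →L[ℝ] X) (z : X × (W →L[ℝ] X)) :
    diagOp e z = (e z.1, e ∘L z.2) := rfl

theorem norm_tangentOp_le (E : W →L[ℝ] X →L[ℝ] X) (b : X →L[ℝ] X) {C : ℝ} (hb : ‖b‖ ≤ C) :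
    ‖tangentOp E b‖ ≤ C + C * (1 + ‖E‖ * C) := by
  have hC : 0 ≤ C := (norm_nonneg _).trans hb
  refine ContinuousLinearMap.opNorm_le_bound _ (by positivity) fun z => ?_
  have h1 : ‖b z.1‖ ≤ C * ‖z‖ := (b.le_of_opNorm_le hb _).trans (by gcongr; exact norm_fst_le z)
  have h2 : ‖b ∘L (z.2 + E.flip (b z.1))‖ ≤ C * (1 + ‖E‖ * C) * ‖z‖ := by
    calc _ ≤ ‖b‖ * ‖z.2 + E.flip (b z.1)‖ := ContinuousLinearMap.opNorm_comp_le _ _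
      _ ≤ C * (‖z‖ + ‖E‖ * (C * ‖z‖)) := by
          gcongr
          refine (norm_add_le _ _).trans (add_le_add (norm_snd_le z) ?_)
          refine (E.flip.le_opNorm _).trans ?_
          rw [ContinuousLinearMap.opNorm_flip]
          gcongr
      _ = _ := by ring
  rw [tangentOp_apply, Prod.norm_def]
  have h3 : 0 ≤ C * ‖z‖ := by positivity
  have h4 : 0 ≤ C * (1 + ‖E‖ * C) * ‖z‖ := by positivity
  exact max_le (by linarith) (by linarith)

namespace LossyFamily

variable {M : Set W} {I : X →L[ℝ] X} {E : W →L[ℝ] X →L[ℝ] X} {B : W → X →L[ℝ] X} {v : W → X}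

/-- `E(·) v(w)` is in the closure of the range of composition with `I`. -/
theorem flip_mem (h : LossyFamily M I E B v) {w : W} (hw : w ∈ M) :
    E.flip (v w) ∈ closure (range (ContinuousLinearMap.compL ℝ W X X I)) := by
  refine map_mem_closure E.flip.continuous (h.mem w hw) ?_
  rintro _ ⟨x, rfl⟩
  refine ⟨E.flip x, ?_⟩
  ext δ
  simp [h.comm_E]

theorem comp_comm (h : LossyFamily M I E B v) {w : W} (hw : w ∈ M) (y : W →L[ℝ] X) :
    I ∘L (B w ∘L y) = B w ∘L (I ∘L y) := by
  ext δ; simp [h.comm_B w hw]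

/-- Composition with `B w` on the space of operators `W →L X` satisfies the same resolvent identity,
so strong convergence there is norm convergence here. Uniformity over the directions in `W` is what
a Fréchet derivative, as opposed to a directional one, requires. -/
theorem tendsto_comp_flip (hM : IsOpen M) (h : LossyFamily M I E B v) {w : W} (hw : w ∈ M) :
    Tendsto (fun w' => B w' ∘L E.flip (v w)) (𝓝 w) (𝓝 (B w ∘L E.flip (v w))) := by
  refine tendsto_apply_of_resolvent (I := ContinuousLinearMap.compL ℝ W X X I)
    (E := ContinuousLinearMap.compL ℝ W X X ∘L E)
    (B := fun w => ContinuousLinearMap.compL ℝ W X X (B w)) hM ?_ ?_ ?_ hw (h.flip_mem hw)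
  · intro w hw y
    exact h.comp_comm hw y
  · intro w hw
    obtain ⟨C, hC⟩ := h.bdd w hw
    refine ⟨C, hC.mono fun w' hw' => ContinuousLinearMap.opNorm_le_bound _
      ((norm_nonneg _).trans hw') fun y => ?_⟩
    exact (ContinuousLinearMap.opNorm_comp_le _ _).trans (by gcongr)
  · intro w hw w' hw' y
    ext δ
    simpa using h.resolvent w hw w' hw' (y δ)

theorem continuousOn_comp_flip (hM : IsOpen M) (h : LossyFamily M I E B v) :
    ContinuousOn (fun w => B w ∘L E.flip (v w)) M := by
  intro w hw
  obtain ⟨C, hC⟩ := h.bdd w hw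
  refine tendsto_apply_apply (B := fun w => ContinuousLinearMap.compL ℝ W X X (B w))
    (v := fun w => E.flip (v w)) (C := C) ?_ ?_ (h.tendsto_comp_flip hM hw)
  · refine hC.mono fun w' hw' => ContinuousLinearMap.opNorm_le_bound _
      ((norm_nonneg _).trans hw') fun y => ?_
    exact (ContinuousLinearMap.opNorm_comp_le _ _).trans (by gcongr)
  · exact E.flip.continuous.continuousAt.comp_continuousWithinAt (h.cont w hw)

/-- The pair of a lossy family and its derivative is a lossy family. -/
theorem tangent (hM : IsOpen M) (h : LossyFamily M I E B v) :
    LossyFamily M (diagOp (W := W) I) (diagOp ∘L E) (fun w => tangentOp E (B w))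
      (fun w => (v w, B w ∘L E.flip (v w))) where
  comm_B w hw z := by
    ext δ
    · simp [h.comm_B w hw]
    · simp [h.comm_B w hw, h.comm_E]
  comm_E w z := by
    ext δ <;> simp [h.comm_E]
  bdd w hw := by
    obtain ⟨C, hC⟩ := h.bdd w hw
    exact ⟨_, hC.mono fun w' hw' => norm_tangentOp_le E (B w') hw'⟩
  resolvent w hw w' hw' z := by
    ext δ
    · simpa using h.resolvent w hw w' hw' z.1
    -- For `z = (x, y)` this component compares `B w' (y + E B w' x)` with `B w (y + E B w x)`. The
    -- identity is used on `y δ`, on `E δ (B w x)`, and, under `B w' (E δ ·)`, on `x`.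
    · have h1 := h.resolvent w hw w' hw' (z.2 δ)
      have h2 := h.resolvent w hw w' hw' (E δ (B w z.1))
      have h3 := h.resolvent w hw w' hw' z.1
      have h4 : B w' (E δ (I (B w' z.1))) = B w' (E δ (I (B w z.1)))
          - B w' (E δ (B w' (E (w' - w) (B w z.1)))) := by
        rw [map_sub, sub_eq_iff_eq_add] at h3
        rw [h3]
        simp; abel
      simp only [map_sub, h.comm_B w' hw', h.comm_B w hw, h.comm_E] at h1 h2 h3 h4 ⊢
      simp [h.comm_B w hw, h.comm_B w' hw', h.comm_E] at h1 h2 h4 ⊢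
      rw [sub_eq_iff_eq_add] at h1 h2
      rw [h1, h4, h2]
      abel
  cont := h.cont.prodMk (h.continuousOn_comp_flip hM)
  mem w hw := by
    -- This continuous map intertwines `I` with `diagOp I`, so it carries the closure of one range
    -- into the closure of the other.
    have : (fun x : X => (x, B w ∘L E.flip x)) (v w) ∈ closure (range (diagOp (W := W) I)) := by
      refine map_mem_closure (s := range I) (f := fun x : X => (x, B w ∘L E.flip x)) ?_
        (h.mem w hw) ?_
      · have h1 : Continuous fun x : X => B w ∘L E.flip x :=
          (ContinuousLinearMap.compL ℝ W X X (B w)).continuous.comp E.flip.continuous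
        fun_prop
      · rintro _ ⟨x, rfl⟩
        refine ⟨(x, B w ∘L E.flip x), ?_⟩
        ext δ <;> simp [h.comm_B w hw, h.comm_E]
    exact this
  resolvent_vec w hw w' hw' := by
    ext δ
    · simpa using h.resolvent_vec w hw w' hw'
    · have h2 := h.resolvent w hw w' hw' (E δ (v w))
      have h3 := h.resolvent_vec w hw w' hw'
      have h4 : B w' (E δ (I (v w'))) = B w' (E δ (I (v w)))
          - B w' (E δ (B w' (E (w' - w) (v w)))) := by
        rw [map_sub, sub_eq_iff_eq_add] at h3
        rw [h3]
        simp; abel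
      simp [h.comm_B w hw, h.comm_B w' hw', h.comm_E] at h2 h4 ⊢
      rw [sub_eq_iff_eq_add] at h2
      rw [h4, h2]
      abel

/-- The resolvent identity gives the increment exactly, as `-I^j B(w + δ) E(δ) v(w)`. The
linearization error only replaces `B(w + δ)` by `B(w + δ) - B(w)`, which is small in operator norm
after composition with `E(·) v(w)`. -/
theorem hasFDerivAt (hM : IsOpen M) (h : LossyFamily M I E B v) (j : ℕ) {w : W} (hw : w ∈ M) :
    HasFDerivAt (fun w => (I ^ (j + 1)) (v w)) (-((I ^ j) ∘L (B w ∘L E.flip (v w)))) w := by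
  rw [hasFDerivAt_iff_isLittleO_nhds_zero, Asymptotics.isLittleO_iff]
  intro ε hε
  have h0 : Tendsto (fun w' => w + w') (𝓝 0) (𝓝 w) := by
    have h1 : Continuous fun w' : W => w + w' := by fun_prop
    simpa using h1.tendsto 0
  have h1 := (h.tendsto_comp_flip hM hw).comp h0
  have h2 : Tendsto (fun δ => ‖I ^ j‖ * ‖B (w + δ) ∘L E.flip (v w) - B w ∘L E.flip (v w)‖)
      (𝓝 0) (𝓝 0) := by
    have := (h1.sub_const (B w ∘L E.flip (v w))).norm.const_mul ‖I ^ j‖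
    simpa using this
  filter_upwards [h2.eventually (gt_mem_nhds hε), h0.eventually (hM.mem_nhds hw)] with δ h3 h4
  have h5 : (I ^ (j + 1)) (v (w + δ)) - (I ^ (j + 1)) (v w) -
      (-((I ^ j) ∘L (B w ∘L E.flip (v w)))) δ =
      -((I ^ j) ((B (w + δ) ∘L E.flip (v w) - B w ∘L E.flip (v w)) δ)) := by
    have := h.resolvent_vec w hw _ h4
    rw [add_sub_cancel_left] at this
    rw [← map_sub, pow_succ, mul_apply_eq_comp, this]
    simp; abel
  rw [h5, norm_neg]
  calc _ ≤ ‖I ^ j‖ * (‖B (w + δ) ∘L E.flip (v w) - B w ∘L E.flip (v w)‖ * ‖δ‖) :=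
        ((I ^ j).le_opNorm _).trans (by gcongr; exact ContinuousLinearMap.le_opNorm _ _)
    _ ≤ ε * ‖δ‖ := by rw [← mul_assoc]; gcongr

end LossyFamily

theorem diagOp_pow_apply (I : X →L[ℝ] X) (j : ℕ) (z : X × (W →L[ℝ] X)) :
    (diagOp I ^ j) z = ((I ^ j) z.1, (I ^ j) ∘L z.2) := by
  induction j generalizing z with
  | zero => rfl
  | succ j ih =>
    rw [pow_succ, mul_apply_eq_comp, ih, pow_succ]
    rfl

end LossyCalculus

/-- After `j` integrations a lossy family is of class `C^j`. -/
theorem LossyFamily.contDiffOn {W : Type u} [NormedAddCommGroup W] [NormedSpace ℝ W] {M : Set W}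
    (hM : IsOpen M) (j : ℕ) :
    ∀ {X : Type u} [NormedAddCommGroup X] [NormedSpace ℝ X] {I : X →L[ℝ] X}
      {E : W →L[ℝ] X →L[ℝ] X} {B : W → X →L[ℝ] X} {v : W → X}, LossyFamily M I E B v →
      ContDiffOn ℝ j (fun w => (I ^ j) (v w)) M := by
  induction j with
  | zero =>
    intro X _ _ I E B v h
    simpa using h.cont
  | succ j ih =>
    intro X _ _ I E B v h
    -- The induction hypothesis is applied on `X × (W →L X)`. The second component of its conclusion
    -- says that the derivative, up to sign, is of class C^j.
    have key := ih (h.tangent hM)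
    simp only [diagOp_pow_apply] at key
    rw [Nat.cast_succ, contDiffOn_succ_iff_hasFDerivWithinAt_of_uniqueDiffOn hM.uniqueDiffOn]
    refine ⟨by simp, fun w => -((I ^ j) ∘L (B w ∘L E.flip (v w))), key.snd.neg, fun w hw => ?_⟩
    exact (h.hasFDerivAt hM j hw).hasFDerivWithinAt

/-! ### Causal functions up to a finite time -/

/-- Continuous functions that vanish for `t ≤ 0` and are constant for `t ≥ T`. -/
def causalSubmodule (H : Type*) [NormedAddCommGroup H] [NormedSpace ℝ H] (T : ℝ) :
    Submodule ℝ (ℝ →ᵇ H) where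
  carrier := {u | (∀ t ≤ 0, u t = 0) ∧ ∀ t, T ≤ t → u t = u T}
  add_mem' hu hv := ⟨fun t ht => by simp [hu.1 t ht, hv.1 t ht],
    fun t ht => by simp [hu.2 t ht, hv.2 t ht]⟩
  zero_mem' := by simp
  smul_mem' c _ hu := ⟨fun t ht => by simp [hu.1 t ht], fun t ht => by simp [hu.2 t ht]⟩

/-- The continuous functions on `[0, T]` that vanish at `0`, represented by their extensions to `ℝ`
that vanish for `t ≤ 0` and are constant for `t ≥ T`. -/
def CausalSpace (H : Type*) [NormedAddCommGroup H] [NormedSpace ℝ H] (T : ℝ) : Type _ :=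
  causalSubmodule H T

namespace CausalSpace

variable {H : Type*} [NormedAddCommGroup H] [NormedSpace ℝ H] {T : ℝ}

instance : NormedAddCommGroup (CausalSpace H T) :=
  inferInstanceAs (NormedAddCommGroup (causalSubmodule H T))

instance : NormedSpace ℝ (CausalSpace H T) :=
  inferInstanceAs (NormedSpace ℝ (causalSubmodule H T))

instance : FunLike (CausalSpace H T) ℝ H where
  coe u := (Subtype.val u : ℝ →ᵇ H)
  coe_injective _ _ h := Subtype.ext (DFunLike.coe_injective h)

theorem apply_nonpos (u : CausalSpace H T) {t : ℝ} (ht : t ≤ 0) : u t = 0   :=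
  u.property.1 t ht

theorem apply_min (u : CausalSpace H T) (t : ℝ) : u (min t T) = u t := by
  rcases le_total t T with h | h
  · rw [min_eq_left h]
  · rw [min_eq_right h]
    exact (u.property.2 t h).symm

theorem continuous (u : CausalSpace H T) : Continuous u :=
  (Subtype.val u).continuous

theorem norm_apply_le (u : CausalSpace H T) (t : ℝ) : ‖u t‖ ≤ ‖u‖ :=
  (Subtype.val u).norm_coe_le_norm t

@[simp] protected theorem add_apply (u v : CausalSpace H T) (t : ℝ) : (u + v) t = u t + v t := rfl
@[simp] protected theorem sub_apply (u v : CausalSpace H T) (t : ℝ) : (u - v) t = u t - v t := rfl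
@[simp] protected theorem neg_apply (u : CausalSpace H T) (t : ℝ) : (-u) t = -u t := rfl
@[simp] protected theorem smul_apply (c : ℝ) (u : CausalSpace H T) (t : ℝ) : (c • u) t = c • u t := rfl
@[simp] protected theorem zero_apply (t : ℝ) : (0 : CausalSpace H T) t = 0 := rfl

theorem norm_le (u : CausalSpace H T) {C : ℝ} (hC : 0 ≤ C) (h : ∀ t ∈ Icc 0 T, ‖u t‖ ≤ C) :
    ‖u‖ ≤ C := by
  refine (BoundedContinuousFunction.norm_le hC).2 fun t => ?_
  change ‖u t‖ ≤ C
  rw [← apply_min u]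
  rcases le_total (min t T) 0 with h0 | h0
  · rw [apply_nonpos u h0]; simpa using hC
  · exact h _ ⟨h0, min_le_right _ _⟩

theorem ext_Icc {u v : CausalSpace H T} (h : ∀ t ∈ Icc 0 T, u t = v t) : u = v := by
  rw [← sub_eq_zero, ← norm_le_zero_iff]
  exact norm_le _ le_rfl fun t ht => by simp [h t ht]

theorem ext {u v : CausalSpace H T} (h : ∀ t, u t = v t) : u = v := ext_Icc fun t _ => h t

instance [CompleteSpace H] : CompleteSpace (CausalSpace H T) := by
  have h1 : ∀ t, Continuous fun u : ℝ →ᵇ H => u t := fun t =>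
    continuous_eval_const t
  have h2 : (causalSubmodule H T : Set (ℝ →ᵇ H)) =
      (⋂ t ≤ (0 : ℝ), {u | u t = 0}) ∩ ⋂ t ≥ T, {u | u t = u T} := by
    ext u
    simp [causalSubmodule]
  have h3 : IsClosed (causalSubmodule H T : Set (ℝ →ᵇ H)) := by
    rw [h2]
    exact (isClosed_biInter fun t _ => isClosed_eq (h1 t) continuous_const).inter
      (isClosed_biInter fun t _ => isClosed_eq (h1 t) (h1 T))
  exact h3.completeSpace_coe

omit [NormedSpace ℝ H] in
theorem bddAbove_norm_truncate {F : ℝ → H} (hF : Continuous F) (h0 : ∀ t ≤ 0, F t = 0) (T : ℝ) :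
    ∃ C, ∀ t, ‖F (min t T)‖ ≤ C := by
  obtain ⟨C, hC⟩ := isCompact_Icc.exists_bound_of_continuousOn (s := Icc 0 T) hF.continuousOn
  refine ⟨max C 0, fun t => ?_⟩
  rcases le_total (min t T) 0 with h | h
  · rw [h0 _ h]; simp
  · exact (hC _ ⟨h, min_le_right _ _⟩).trans (le_max_left _ _)

/-- The element of `CausalSpace H T` that agrees with `F` on `[0, T]`. -/
def truncate (T : ℝ) (F : ℝ → H) (hF : Continuous F) (h0 : ∀ t ≤ 0, F t = 0) : CausalSpace H T :=
  ⟨BoundedContinuousFunction.ofNormedAddCommGroup (fun t => F (min t T)) (by fun_prop)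
      (bddAbove_norm_truncate hF h0 T).choose (bddAbove_norm_truncate hF h0 T).choose_spec,
    fun t ht => h0 _ ((min_le_left _ _).trans ht), fun t ht => by
      simp [min_eq_right ht]⟩

theorem truncate_apply {F : ℝ → H} (hF : Continuous F) (h0 : ∀ t ≤ 0, F t = 0) (t : ℝ) :
    (truncate T F hF h0) t = F (min t T) := rfl

theorem truncate_apply_of_le {F : ℝ → H} (hF : Continuous F) (h0 : ∀ t ≤ 0, F t = 0) {t : ℝ}
    (ht : t ≤ T) : (truncate T F hF h0) t = F t := by rw [truncate_apply, min_eq_left ht]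

/-- Pointwise application of an operator. -/
def lift : (H →L[ℝ] H) →L[ℝ] CausalSpace H T →L[ℝ] CausalSpace H T :=
  LinearMap.mkContinuous₂
    (LinearMap.mk₂ ℝ (fun (A : H →L[ℝ] H) u =>
        truncate T (fun t => A (u t)) (A.continuous.comp u.continuous)
          fun t ht => by simp [u.apply_nonpos ht])
      (fun _ _ _ => ext fun t => by simp [truncate_apply]) (fun _ _ _ => ext fun t => by simp [truncate_apply])
      (fun _ _ _ => ext fun t => by simp [truncate_apply]) (fun _ _ _ => ext fun t => by simp [truncate_apply]))
    1 fun A u => norm_le _ (by positivity) fun t _ => by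
      rw [one_mul]
      exact A.le_opNorm_of_le (u.norm_apply_le _)

@[simp] theorem lift_apply (A : H →L[ℝ] H) (u : CausalSpace H T) (t : ℝ) :
    lift A u t = A (u t) := congrArg A (u.apply_min t)

theorem continuous_primitive {v : ℝ → H} (hv : Continuous v) :
    Continuous fun t => ∫ s in (0 : ℝ)..t, v s :=
  intervalIntegral.continuous_primitive (fun _ _ => hv.intervalIntegrable _ _) 0

theorem primitive_nonpos {v : ℝ → H} (h0 : ∀ t ≤ 0, v t = 0) {t : ℝ} (ht : t ≤ 0) :
    ∫ s in (0 : ℝ)..t, v s = 0 := by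
  rw [intervalIntegral.integral_congr (g := fun _ => (0 : H)), intervalIntegral.integral_zero]
  intro s hs
  rw [uIcc_of_ge ht] at hs
  exact h0 s hs.2

/-- Integration from `0` to `t`. -/
def integ : CausalSpace H T →L[ℝ] CausalSpace H T :=
  LinearMap.mkContinuous
    { toFun u := truncate T (fun t => ∫ s in (0 : ℝ)..t, u s) (continuous_primitive u.continuous)
        fun t ht => primitive_nonpos (fun t ht => u.apply_nonpos ht) ht
      map_add' u v := ext fun t => intervalIntegral.integral_add
        (u.continuous.intervalIntegrable _ _) (v.continuous.intervalIntegrable _ _)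
      map_smul' c u := ext fun t => intervalIntegral.integral_smul c _ }
    |T| fun u => norm_le _ (by positivity) fun t ht => by
      have := intervalIntegral.norm_integral_le_of_norm_le_const (a := 0) (b := min t T)
        (f := u) (C := ‖u‖) fun s _ => u.norm_apply_le s
      refine this.trans ?_
      rw [mul_comm]
      have h1 : 0 ≤ min t T := le_min ht.1 (ht.1.trans ht.2)
      gcongr
      · simp

theorem integ_apply_min (u : CausalSpace H T) (t : ℝ) :
    integ u t = ∫ s in (0 : ℝ)..(min t T), u s := rfl

theorem integ_apply (u : CausalSpace H T) {t : ℝ} (ht : t ≤ T) :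
    integ u t = ∫ s in (0 : ℝ)..t, u s := by rw [integ_apply_min, min_eq_left ht]

theorem norm_integ_apply_le (u : CausalSpace H T) {t : ℝ} (ht : t ∈ Icc 0 T) :
    ‖integ u t‖ ≤ ∫ s in (0 : ℝ)..t, ‖u s‖ := by
  rw [integ_apply u ht.2]
  exact intervalIntegral.norm_integral_le_integral_norm ht.1

theorem integ_lift [CompleteSpace H] (A : H →L[ℝ] H) (u : CausalSpace H T) :
    integ (lift A u) = lift A (integ u) :=
  ext fun t => by
    simp only [lift_apply, integ_apply_min]
    exact A.intervalIntegral_comp_comm (u.continuous.intervalIntegrable _ _)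

/-- Backward difference quotients approximate the inverse of `integ`. -/
theorem denseRange_integ [CompleteSpace H] :
    closure (range (integ : CausalSpace H T →L[ℝ] CausalSpace H T)) = univ := by
  refine eq_univ_of_forall fun u => Metric.mem_closure_iff.2 fun η hη => ?_
  -- The interval starts at `-1` because the backward shift by `ε ≤ 1` may leave `[0, T]`; the
  -- vanishing of `u` on negative times then handles `t` near 0.
  have huc := (isCompact_Icc (a := -1) (b := T)).uniformContinuousOn_of_continuous
    u.continuous.continuousOn
  obtain ⟨δ, hδ, hδu⟩ := Metric.uniformContinuousOn_iff.1 huc (η / 2) (half_pos hη)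
  set ε := min (δ / 2) 1 with hε
  have hε0 : 0 < ε := lt_min (half_pos hδ) one_pos
  have hcont : Continuous fun t => ε⁻¹ • (u t - u (t - ε)) := by
    have := u.continuous; fun_prop
  refine ⟨_, ⟨truncate T _ hcont fun t ht => ?_, rfl⟩, ?_⟩
  · rw [u.apply_nonpos ht, u.apply_nonpos (by linarith)]; simp
  rw [dist_eq_norm]
  refine lt_of_le_of_lt (norm_le _ (half_pos hη).le fun t ht => ?_) (half_lt_self hη)
  have hi : ∀ a b, IntervalIntegrable u volume a b := fun a b => u.continuous.intervalIntegrable _ _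
  have hz : ∫ s in (-ε)..0, u s = 0 := by
    rw [intervalIntegral.integral_symm, primitive_nonpos (fun t ht => u.apply_nonpos ht) (by linarith),
      neg_zero]
  have h1 : (integ (truncate T _ hcont fun t ht => by
      rw [u.apply_nonpos ht, u.apply_nonpos (by linarith)]; simp)) t =
      ε⁻¹ • ∫ s in (t - ε)..t, u s := by
    rw [integ_apply _ ht.2]
    rw [intervalIntegral.integral_congr (g := fun s => ε⁻¹ • (u s - u (s - ε)))]
    · have hi' : IntervalIntegrable (fun s => u (s - ε)) volume 0 t :=
        (u.continuous.comp (continuous_id.sub continuous_const)).intervalIntegrable _ _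
      rw [intervalIntegral.integral_smul, intervalIntegral.integral_sub (hi _ _) hi',
        intervalIntegral.integral_comp_sub_right (fun s => u s), zero_sub,
        ← intervalIntegral.integral_add_adjacent_intervals (hi (-ε) 0) (hi 0 (t - ε)), hz, zero_add,
        intervalIntegral.integral_interval_sub_left (hi _ _) (hi _ _)]
    · intro s hs
      rw [uIcc_of_le ht.1] at hs
      exact truncate_apply_of_le _ _ (hs.2.trans ht.2)
  rw [CausalSpace.sub_apply, h1]
  have h2 : u t = ε⁻¹ • ∫ s in (t - ε)..t, u t := by
    rw [intervalIntegral.integral_const, sub_sub_cancel, inv_smul_smul₀ hε0.ne']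
  rw [h2, ← smul_sub, ← intervalIntegral.integral_sub (by simp) (hi _ _), norm_smul, norm_inv,
    Real.norm_of_nonneg hε0.le]
  have h3 : ‖∫ s in (t - ε)..t, (u t - u s)‖ ≤ η / 2 * |t - (t - ε)| := by
    refine intervalIntegral.norm_integral_le_of_norm_le_const fun s hs => ?_
    rw [uIoc_of_le (by linarith)] at hs
    rw [← dist_eq_norm]
    have h4 : ε ≤ 1 := min_le_right _ _
    have h5 : ε ≤ δ / 2 := min_le_left _ _
    refine (hδu t ⟨by linarith [ht.1], ht.2⟩ s ⟨by linarith [ht.1, hs.1], by linarith [hs.2, ht.2]⟩ ?_).le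
    rw [Real.dist_eq, abs_lt]
    constructor <;> linarith [hs.1, hs.2]
  rw [sub_sub_cancel, abs_of_pos hε0] at h3
  calc ε⁻¹ * _ ≤ ε⁻¹ * (η / 2 * ε) := by gcongr
    _ = η / 2 := by field_simp

/-! ### Volterra operators -/

/-- `N` satisfies the bounds of an integral operator with a kernel bounded by `ρ`. -/
def IsVolterra (N : CausalSpace H T →L[ℝ] CausalSpace H T) (ρ : ℝ) : Prop :=
  ∀ (u : CausalSpace H T) (R : ℝ) (j : ℕ), 0 ≤ R → (∀ s ∈ Icc 0 T, ‖u s‖ ≤ R * s ^ j) →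
    ∀ t ∈ Icc 0 T, ‖N u t‖ ≤ ρ * (R * t ^ (j + 1) / (j + 1))

theorem integral_mul_pow (R t : ℝ) (j : ℕ) :
    ∫ s in (0 : ℝ)..t, R * s ^ j = R * t ^ (j + 1) / (j + 1) := by
  rw [intervalIntegral.integral_const_mul, integral_pow]
  simp [mul_div_assoc]

/-- `K` is causal and bounded by `κ` on every interval `[0, t]`. -/
def IsCausalOp (K : CausalSpace H T →L[ℝ] CausalSpace H T) (κ : ℝ) : Prop :=
  ∀ (u : CausalSpace H T) (R t : ℝ), t ∈ Icc 0 T → (∀ s ∈ Icc 0 t, ‖u s‖ ≤ R) → ‖K u t‖ ≤ κ * R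

/-- On `[0, s]` a bound by `r ^ j` is a bound by `s ^ j`, so causality transfers it to `K u` at time
`s`. Integration gains the factor `t / (j + 1)`; these factors accumulate to `t ^ j / j!` under
iteration. -/
theorem IsCausalOp.integral_norm_le {K : CausalSpace H T →L[ℝ] CausalSpace H T} {κ : ℝ}
    (hK : IsCausalOp K κ) {u : CausalSpace H T} {R : ℝ} {j : ℕ} (hR : 0 ≤ R)
    (hu : ∀ s ∈ Icc 0 T, ‖u s‖ ≤ R * s ^ j) {t : ℝ} (ht : t ∈ Icc 0 T) :
    ∫ s in (0 : ℝ)..t, ‖K u s‖ ≤ κ * (R * t ^ (j + 1) / (j + 1)) := by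
  rw [← integral_mul_pow, ← intervalIntegral.integral_const_mul]
  refine intervalIntegral.integral_mono_on ht.1 ((K u).continuous.norm.intervalIntegrable _ _)
    (by apply Continuous.intervalIntegrable; fun_prop) fun s hs => ?_
  refine hK u _ s ⟨hs.1, hs.2.trans ht.2⟩ fun r hr =>
    (hu r ⟨hr.1, hr.2.trans (hs.2.trans ht.2)⟩).trans ?_
  have := hr.1
  have := hr.2
  gcongr

theorem IsVolterra.of_integral_le {N K : CausalSpace H T →L[ℝ] CausalSpace H T} {κ : ℝ}
    (hK : IsCausalOp K κ) {c : ℝ} (hc : 0 ≤ c)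
    (hN : ∀ u : CausalSpace H T, ∀ t ∈ Icc 0 T, ‖N u t‖ ≤ c * ∫ s in (0 : ℝ)..t, ‖K u s‖) :
    IsVolterra N (c * κ) := by
  intro u R j hR hu t ht
  refine (hN u t ht).trans ?_
  rw [mul_assoc]
  gcongr
  exact hK.integral_norm_le hR hu ht

/-- A Gronwall lemma for causal operators. -/
theorem IsCausalOp.eq_zero {K : CausalSpace H T →L[ℝ] CausalSpace H T} {κ : ℝ}
    (hK : IsCausalOp K κ) (hκ : 0 ≤ κ) {c : ℝ} (hc : 0 ≤ c) {u : CausalSpace H T}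
    (hu : ∀ t ∈ Icc 0 T, ‖u t‖ ≤ c * ∫ s in (0 : ℝ)..t, ‖K u s‖) : u = 0 := by
  have key : ∀ j : ℕ, ∀ t ∈ Icc 0 T, ‖u t‖ ≤ (c * κ) ^ j / j.factorial * ‖u‖ * t ^ j := by
    intro j
    induction j with
    | zero => intro t _; simpa using u.norm_apply_le t
    | succ j ih =>
      intro t ht
      refine (hu t ht).trans ?_
      have := hK.integral_norm_le (by positivity) ih ht
      refine (mul_le_mul_of_nonneg_left this hc).trans (le_of_eq ?_)
      rw [Nat.factorial_succ]
      push_cast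
      field_simp
      ring
  refine ext_Icc fun t ht => ?_
  rw [CausalSpace.zero_apply, ← norm_le_zero_iff]
  refine ge_of_tendsto' (x := atTop) (f := fun j : ℕ => (c * κ * t) ^ j / j.factorial * ‖u‖) ?_
    fun j => (key j t ht).trans (le_of_eq ?_)
  · simpa using (FloorSemiring.tendsto_pow_div_factorial_atTop (c * κ * t)).mul_const ‖u‖
  · rw [mul_pow (c * κ)]; ring

theorem IsVolterra.norm_pow_apply_le {N : CausalSpace H T →L[ℝ] CausalSpace H T} {ρ : ℝ}
    (hN : IsVolterra N ρ) (hρ : 0 ≤ ρ) (u : CausalSpace H T) (j : ℕ) :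
    ∀ t ∈ Icc 0 T, ‖((N ^ j) u) t‖ ≤ ρ ^ j / j.factorial * ‖u‖ * t ^ j := by
  induction j with
  | zero => intro t _; simpa using u.norm_apply_le t
  | succ j ih =>
    intro t ht
    rw [pow_succ', mul_apply_eq_comp]
    refine (hN _ _ j (by positivity) ih t ht).trans (le_of_eq ?_)
    rw [Nat.factorial_succ]
    push_cast
    field_simp
    ring

theorem IsVolterra.norm_pow_le {N : CausalSpace H T →L[ℝ] CausalSpace H T} {ρ : ℝ}
    (hN : IsVolterra N ρ) (hρ : 0 ≤ ρ) (hT : 0 ≤ T) (j : ℕ) :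
    ‖N ^ j‖ ≤ (ρ * T) ^ j / j.factorial := by
  refine ContinuousLinearMap.opNorm_le_bound _ (by positivity) fun u =>
    norm_le _ (by positivity) fun t ht => (hN.norm_pow_apply_le hρ u j t ht).trans ?_
  have := ht.1
  have := ht.2
  calc ρ ^ j / j.factorial * ‖u‖ * t ^ j ≤ ρ ^ j / j.factorial * ‖u‖ * T ^ j := by gcongr
    _ = _ := by rw [mul_pow]; ring

/-- If `N` is a Volterra operator then `1 + N` is invertible. -/
theorem IsVolterra.exists_inverse [CompleteSpace H] {N : CausalSpace H T →L[ℝ] CausalSpace H T}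
    {ρ : ℝ} (hN : IsVolterra N ρ) (hρ : 0 ≤ ρ) (hT : 0 ≤ T) :
    ∃ S : CausalSpace H T →L[ℝ] CausalSpace H T, S * (1 + N) = 1 ∧ (1 + N) * S = 1 ∧
      ‖S‖ ≤ Real.exp (ρ * T) := by
  have hN' : IsVolterra (-N) ρ := fun u R j hR hu t ht => by
    simpa using hN u R j hR hu t ht
  have hb := hN'.norm_pow_le hρ hT
  have hsum := Real.summable_pow_div_factorial (ρ * T)
  -- The Neumann series is dominated by the exponential series, so neither `N` nor `T` has to be
  -- small.
  have hs : Summable ((-N) ^ ·) := Summable.of_norm_bounded hsum hb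
  refine ⟨∑' j, (-N) ^ j, ?_, ?_, ?_⟩
  · simpa using hs.tsum_pow_mul_one_sub
  · simpa using hs.one_sub_mul_tsum_pow
  · refine (tsum_of_norm_bounded hsum.hasSum hb).trans (le_of_eq ?_)
    rw [Real.exp_eq_exp_ℝ, NormedSpace.exp_eq_tsum_div]

end CausalSpace

/-! ### Skew-adjoint operators -/

namespace IsSkewAdjoint

variable {H : Type*} [NormedAddCommGroup H] [InnerProductSpace ℝ H] [CompleteSpace H]
  {P : H →ₗ.[ℝ] H}

theorem inner_eq_neg (hP : IsSkewAdjoint P) (x y : P.domain) : ⟪P x, (y : H)⟫ = -⟪(x : H), P y⟫ := by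
  have h := LinearPMap.adjoint_isFormalAdjoint (T := P) hP.1
  rw [hP.2] at h
  have h1 : ⟪-P x, (y : H)⟫ = ⟪(x : H), P y⟫ := h x y
  rw [inner_neg_left] at h1
  linarith

/-- This is the maximality in skew-adjointness: the domain of the adjoint is no larger than that of
`P`. -/
theorem mem_graph_of_inner (hP : IsSkewAdjoint P) {y w : H}
    (h : ∀ x : P.domain, ⟪w, (x : H)⟫ = ⟪y, P x⟫) : (y, -w) ∈ P.graph := by
  have h1 := LinearPMap.mem_adjoint_domain_of_exists (T := P) y ⟨w, h⟩
  have h2 := LinearPMap.adjoint_apply_eq hP.1 ⟨y, h1⟩ h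
  have h3 : (y, w) ∈ P.adjoint.graph := by
    rw [LinearPMap.mem_graph_iff]
    exact ⟨⟨y, h1⟩, rfl, h2⟩
  rw [hP.2, LinearPMap.mem_graph_iff] at h3
  obtain ⟨z, hz, hz'⟩ := h3
  refine (LinearPMap.mem_graph_iff P).2 ⟨z, hz, ?_⟩
  have h4 : -P z = w := hz'
  simp [← h4]

theorem inner_graph (hP : IsSkewAdjoint P) {z : H × H} (h : z ∈ P.graph) : ⟪z.2, z.1⟫ = 0 := by
  obtain ⟨v, hv, hv'⟩ := (LinearPMap.mem_graph_iff P).1 h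
  have h1 := hP.inner_eq_neg v v
  rw [hv, hv', real_inner_comm] at h1
  rw [real_inner_comm]
  linarith

theorem isClosed_graph (hP : IsSkewAdjoint P) : IsClosed (P.graph : Set (H × H)) := by
  have h1 : IsClosed (P.adjoint.graph : Set (H × H)) := LinearPMap.adjoint_isClosed hP.1
  have h2 : Continuous fun z : H × H => (z.1, -z.2) := by fun_prop
  have h3 : (P.graph : Set (H × H)) = (fun z : H × H => (z.1, -z.2)) ⁻¹' P.adjoint.graph := by
    ext z
    simp only [SetLike.mem_coe, mem_preimage, hP.2, LinearPMap.mem_graph_iff]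
    refine exists_congr fun v => and_congr_right fun _ => ?_
    change P v = z.2 ↔ -P v = -z.2
    simp
  rw [h3]
  exact h1.preimage h2

theorem norm_sq_graph (hP : IsSkewAdjoint P) {z : H × H} (h : z ∈ P.graph) (r : ℝ) :
    ‖z.1 + r • z.2‖ ^ 2 = ‖z.1‖ ^ 2 + (r * ‖z.2‖) ^ 2 := by
  have h1 := hP.inner_graph h
  rw [real_inner_comm] at h1
  rw [norm_add_sq_real, inner_smul_right, h1, norm_smul, mul_pow, mul_pow]
  simp

/-- The map `(x, P x) ↦ x + r P x`. -/
def graphMap (P : H →ₗ.[ℝ] H) (r : ℝ) : P.graph →L[ℝ] H :=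
  (ContinuousLinearMap.fst ℝ H H + r • ContinuousLinearMap.snd ℝ H H) ∘L P.graph.subtypeL

omit [CompleteSpace H] in
theorem graphMap_apply (r : ℝ) (z : P.graph) : graphMap P r z = z.1.1 + r • z.1.2 := rfl

theorem norm_le_graphMap (hP : IsSkewAdjoint P) {r : ℝ} (hr : 0 < r) (z : P.graph) :
    ‖z‖ ≤ max 1 r⁻¹ * ‖graphMap P r z‖ := by
  have h := hP.norm_sq_graph z.2 r
  rw [← graphMap_apply] at h
  have h1 : ‖z.1.1‖ ≤ ‖graphMap P r z‖ :=
    abs_le_of_sq_le_sq' (by nlinarith [sq_nonneg (r * ‖z.1.2‖)]) (norm_nonneg _) |>.2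
  have h2 : r * ‖z.1.2‖ ≤ ‖graphMap P r z‖ :=
    abs_le_of_sq_le_sq' (by nlinarith [sq_nonneg ‖z.1.1‖]) (norm_nonneg _) |>.2
  change ‖z.1‖ ≤ _
  rw [Prod.norm_def]
  refine max_le ?_ ?_
  · calc ‖z.1.1‖ ≤ 1 * ‖graphMap P r z‖ := by rwa [one_mul]
      _ ≤ _ := by gcongr; exact le_max_left _ _
  · calc ‖z.1.2‖ = r⁻¹ * (r * ‖z.1.2‖) := by field_simp
      _ ≤ r⁻¹ * ‖graphMap P r z‖ := by gcongr
      _ ≤ _ := by gcongr; exact le_max_right _ _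

/-- Since `P x` is orthogonal to `x`, the map `1 + r P` is bounded below on a closed graph, hence
injective with closed range. A vector `y` orthogonal to the range lies in the domain of the adjoint,
thus in that of `P`, with `P y = r⁻¹ y`; orthogonality of `P y` and `y` forces `y = 0`. -/
theorem graphMap_bijective (hP : IsSkewAdjoint P) {r : ℝ} (hr : 0 < r) :
    LinearMap.ker (graphMap P r).toLinearMap = ⊥ ∧ LinearMap.range (graphMap P r).toLinearMap = ⊤ := by
  have hcomp : CompleteSpace P.graph := hP.isClosed_graph.completeSpace_coe
  have hanti : AntilipschitzWith (Real.toNNReal (max 1 r⁻¹)) (graphMap P r) := by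
    refine ContinuousLinearMap.antilipschitz_of_bound _ fun z => ?_
    rw [Real.coe_toNNReal _ (zero_le_one.trans (le_max_left _ _))]
    exact hP.norm_le_graphMap hr z
  refine ⟨LinearMap.ker_eq_bot.2 hanti.injective, ?_⟩
  have hclosed : IsClosed ((LinearMap.range (graphMap P r).toLinearMap : Submodule ℝ H) : Set H) :=
    hanti.isClosed_range (graphMap P r).uniformContinuous
  rw [← hclosed.submodule_topologicalClosure_eq, Submodule.topologicalClosure_eq_top_iff,
    Submodule.eq_bot_iff]
  intro y hy
  rw [Submodule.mem_orthogonal'] at hy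
  have h1 : ∀ x : P.domain, ⟪y, (x : H)⟫ + r * ⟪y, P x⟫ = 0 := fun x => by
    have := hy _ ⟨⟨((x : H), P x), P.mem_graph x⟩, rfl⟩
    change ⟪y, (x : H) + r • P x⟫ = 0 at this
    rwa [inner_add_right, inner_smul_right] at this
  have h2 := hP.mem_graph_of_inner (y := y) (w := -(r⁻¹ • y)) fun x => by
    rw [inner_neg_left, real_inner_smul_left]
    have := h1 x
    field_simp
    linarith
  have h3 := hP.inner_graph h2
  rw [neg_neg, real_inner_smul_left, real_inner_self_eq_norm_sq] at h3
  have : r⁻¹ ≠ 0 := (inv_pos.2 hr).ne'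
  simpa [this, hr.ne'] using h3

/-- The resolvent `J = (1 + r P)⁻¹` and the Yosida approximation `Q = P J`. -/
theorem exists_resolvent (hP : IsSkewAdjoint P) {r : ℝ} (hr : 0 < r) :
    ∃ J Q : H →L[ℝ] H, (∀ z, (J z, Q z) ∈ P.graph) ∧ (∀ z, J z + r • Q z = z) ∧
      ∀ z ∈ P.graph, J (z.1 + r • z.2) = z.1 := by
  have hcomp : CompleteSpace P.graph := hP.isClosed_graph.completeSpace_coe
  obtain ⟨h1, h2⟩ := hP.graphMap_bijective hr
  let e := ContinuousLinearEquiv.ofBijective (graphMap P r) h1 h2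
  refine ⟨ContinuousLinearMap.fst ℝ H H ∘L P.graph.subtypeL ∘L (e.symm : H →L[ℝ] P.graph),
    ContinuousLinearMap.snd ℝ H H ∘L P.graph.subtypeL ∘L (e.symm : H →L[ℝ] P.graph),
    fun z => (e.symm z).2, fun z => e.apply_symm_apply z, fun z hz => ?_⟩
  have h3 : e.symm (e ⟨z, hz⟩) = ⟨z, hz⟩ := e.symm_apply_apply _
  exact congrArg (fun y : P.graph => y.1.1) h3

omit [CompleteSpace H] in
theorem mem_graph_iff_graphSpace {z : H × H} :
    z ∈ P.graph ↔ ∃ v : GraphSpace P, GraphSpace.incl P v = z.1 ∧ GraphSpace.op P v = z.2 :=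
  LinearPMap.mem_graph_iff P

/-- The inverse of `1 + P`, as an operator into the domain of `P`. -/
theorem exists_graphSpace_resolvent (hP : IsSkewAdjoint P) :
    ∃ R : H →L[ℝ] GraphSpace P, (∀ v, R (GraphSpace.incl P v + GraphSpace.op P v) = v) ∧
      ∀ x, GraphSpace.incl P (R x) + GraphSpace.op P (R x) = x := by
  -- By orthogonality of `v` and `P v`, the map `1 + P` is an isometry for the graph norm.
  let φ : GraphSpace P →ₗᵢ[ℝ] H :=
    { toLinearMap := GraphSpace.incl P + GraphSpace.op P
      norm_map' := fun v => by
        have h1 : (GraphSpace.incl P v, GraphSpace.op P v) ∈ P.graph :=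
          mem_graph_iff_graphSpace.2 ⟨v, rfl, rfl⟩
        have h2 := hP.norm_sq_graph h1 1
        rw [one_smul, one_mul, ← GraphSpace.norm_sq_eq] at h2
        exact (sq_eq_sq₀ (norm_nonneg _) (norm_nonneg _)).1 h2 }
  have hφ : Function.Surjective φ := fun x => by
    obtain ⟨J, Q, h1, h2, -⟩ := hP.exists_resolvent one_pos
    obtain ⟨v, hv, hv'⟩ := mem_graph_iff_graphSpace.1 (h1 x)
    refine ⟨v, ?_⟩
    change GraphSpace.incl P v + GraphSpace.op P v = x
    rw [hv, hv']
    simpa using h2 x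
  let e := LinearIsometryEquiv.ofSurjective φ hφ
  exact ⟨e.symm.toContinuousLinearEquiv, fun v => e.symm_apply_apply v, fun x => e.apply_symm_apply x⟩

/-- Integration preserves the graph of `P`. -/
theorem integ_mem_graph (hP : IsSkewAdjoint P) {T : ℝ} {a b : CausalSpace H T}
    (h : ∀ t, (a t, b t) ∈ P.graph) (t : ℝ) :
    (CausalSpace.integ a t, CausalSpace.integ b t) ∈ P.graph := by
  obtain ⟨J, Q, h1, h2, h3⟩ := hP.exists_resolvent one_pos
  simp only [one_smul] at h2 h3
  -- Both components are bounded operators applied to `a + b`, and bounded operators commute with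
  -- integration.
  have ha : a = CausalSpace.lift J (a + b) := CausalSpace.ext fun t => by
    simpa using (h3 _ (h t)).symm
  have hb : b = CausalSpace.lift Q (a + b) := CausalSpace.ext fun t => by
    have e1 := h2 (a t + b t)
    rw [h3 _ (h t), add_right_inj] at e1
    simpa using e1.symm
  have hab := h1 (CausalSpace.integ (a + b) t)
  rw [← CausalSpace.lift_apply, ← CausalSpace.lift_apply, ← CausalSpace.integ_lift,
    ← CausalSpace.integ_lift, ← ha, ← hb] at hab
  exact hab

end IsSkewAdjoint

/-! ### The solution operator -/

open CausalSpace

section Solution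

variable {H : Type*} [NormedAddCommGroup H] [InnerProductSpace ℝ H]

/-- `A` is symmetric and bounded below by `c`. -/
def IsCoerciveSymm (A : H →L[ℝ] H) (c : ℝ) : Prop :=
  (∀ x y, ⟪A x, y⟫ = ⟪x, A y⟫) ∧ ∀ x, c * ‖x‖ ^ 2 ≤ ⟪A x, x⟫

/-- An instance of Lax–Milgram. -/
theorem IsCoerciveSymm.exists_inverse [CompleteSpace H] {A : H →L[ℝ] H} {c : ℝ}
    (hA : IsCoerciveSymm A c) (hc : 0 < c) : ∃ A' : H →L[ℝ] H, ∀ x, A (A' x) = x := by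
  have hB : IsCoercive (innerSL ℝ ∘L A) := ⟨c, hc, fun u => by
    have := hA.2 u
    rw [mul_assoc, ← pow_two]
    exact this⟩
  let e := hB.continuousLinearEquivOfBilin
  have he : ∀ x, e x = A x := fun x => by
    refine ext_inner_right ℝ fun y => ?_
    exact hB.continuousLinearEquivOfBilin_apply x y
  exact ⟨e.symm, fun x => by rw [← he]; exact e.apply_symm_apply x⟩

/-! ### Energy estimates -/

variable {T : ℝ}

theorem hasDerivAt_primitive [CompleteSpace H] {v : ℝ → H} (hv : Continuous v) (t : ℝ) :
    HasDerivAt (fun t => ∫ s in (0 : ℝ)..t, v s) (v t) t :=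
  intervalIntegral.integral_hasDerivAt_right (hv.intervalIntegrable _ _)
    hv.aestronglyMeasurable.stronglyMeasurableAtFilter hv.continuousAt

variable [CompleteSpace H]

/-- The energy inequality. -/
theorem energy_le {A : H →L[ℝ] H} (hA : ∀ x y, ⟪A x, y⟫ = ⟪x, A y⟫) (v : CausalSpace H T)
    {η : ℝ → ℝ} (hη : Continuous η) (h : ∀ s ∈ Icc 0 T, ⟪A (v s), integ v s⟫ ≤ η s)
    {t : ℝ} (ht : t ∈ Icc 0 T) : ⟪A (integ v t), integ v t⟫ ≤ 2 * ∫ s in (0 : ℝ)..t, η s := by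
  set u : ℝ → H := fun t => ∫ s in (0 : ℝ)..t, v s with hu
  have hu' : ∀ t ≤ T, integ v t = u t := fun t ht => integ_apply v ht
  have hd : ∀ t, HasDerivAt (fun t => ⟪A (u t), u t⟫) (2 * ⟪A (v t), u t⟫) t := fun t => by
    have h1 := hasDerivAt_primitive v.continuous t
    have h2 := (A.hasFDerivAt.comp_hasDerivAt t h1).inner ℝ h1
    refine h2.congr_deriv ?_
    have h3 : ⟪A (u t), v t⟫ = ⟪A (v t), u t⟫ := by rw [hA, real_inner_comm]
    change ⟪A (u t), v t⟫ + ⟪A (v t), u t⟫ = _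
    rw [h3]
    ring
  have hcu : Continuous u := continuous_primitive v.continuous
  have hci : Continuous fun t => 2 * ⟪A (v t), u t⟫ :=
    continuous_const.mul ((A.continuous.comp v.continuous).inner hcu)
  have h3 := intervalIntegral.integral_eq_sub_of_hasDerivAt (a := 0) (b := t) (fun s _ => hd s)
    (hci.intervalIntegrable _ _)
  have h0 : u 0 = 0 := intervalIntegral.integral_same
  rw [h0, map_zero, inner_zero_left, sub_zero] at h3
  rw [hu' t ht.2, ← h3, ← intervalIntegral.integral_const_mul]
  refine intervalIntegral.integral_mono_on ht.1 (hci.intervalIntegrable _ _)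
    ((continuous_const.mul hη).intervalIntegrable _ _) fun s hs => ?_
  have := h s ⟨hs.1, hs.2.trans ht.2⟩
  rw [hu' s (hs.2.trans ht.2)] at this
  linarith

/-- At a time `r` where the norm of `u = integ v` is maximal on `[0, t]`, the energy inequality
gives `c ‖u(r)‖² ≤ 2 ‖u(r)‖ ∫ ‖f‖`, and one factor cancels. The result is a bound by the L¹ norm of
`f` in time. -/
theorem norm_integ_le_of_inner_nonpos {A : H →L[ℝ] H} {c : ℝ} (hA : IsCoerciveSymm A c) (hc : 0 < c)
    (v f : CausalSpace H T) (h : ∀ s ∈ Icc 0 T, ⟪A (v s) - f s, integ v s⟫ ≤ 0)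
    {t : ℝ} (ht : t ∈ Icc 0 T) : ‖integ v t‖ ≤ 2 / c * ∫ s in (0 : ℝ)..t, ‖f s‖ := by
  obtain ⟨r, hr, hmax⟩ := isCompact_Icc.exists_isMaxOn (nonempty_Icc.2 ht.1)
    (integ v).continuous.norm.continuousOn
  have hfi : ∀ a b, IntervalIntegrable (fun s => ‖f s‖) volume a b := fun a b =>
    f.continuous.norm.intervalIntegrable _ _
  have hint : 0 ≤ ∫ s in (0 : ℝ)..t, ‖f s‖ :=
    intervalIntegral.integral_nonneg ht.1 fun _ _ => norm_nonneg _
  have hrT : r ∈ Icc 0 T := ⟨hr.1, hr.2.trans ht.2⟩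
  refine (hmax (right_mem_Icc.2 ht.1)).trans ?_
  have h1 := energy_le hA.1 v (η := fun s => ‖f s‖ * ‖integ v s‖)
    (f.continuous.norm.mul (integ v).continuous.norm) (fun s hs => by
      have := h s hs
      rw [inner_sub_left] at this
      linarith [real_inner_le_norm (f s) (integ v s)]) hrT
  have h2 : ∫ s in (0 : ℝ)..r, ‖f s‖ * ‖integ v s‖ ≤ (∫ s in (0 : ℝ)..t, ‖f s‖) * ‖integ v r‖ := by
    calc ∫ s in (0 : ℝ)..r, ‖f s‖ * ‖integ v s‖ ≤ ∫ s in (0 : ℝ)..r, ‖f s‖ * ‖integ v r‖ := by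
          refine intervalIntegral.integral_mono_on hr.1
            ((f.continuous.norm.mul (integ v).continuous.norm).intervalIntegrable _ _)
            ((hfi _ _).mul_const _) fun s hs => ?_
          have h3 : ‖integ v s‖ ≤ ‖integ v r‖ := hmax ⟨hs.1, hs.2.trans hr.2⟩
          gcongr
      _ = (∫ s in (0 : ℝ)..r, ‖f s‖) * ‖integ v r‖ := intervalIntegral.integral_mul_const _ _
      _ ≤ _ := by
          gcongr
          exact intervalIntegral.integral_mono_interval le_rfl hr.1 hr.2
            (Eventually.of_forall fun _ => norm_nonneg _) (hfi _ _)
  have h4 := hA.2 (integ v r)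
  change ‖integ v r‖ ≤ _
  rcases (norm_nonneg (integ v r)).eq_or_lt with h0 | h0
  · rw [← h0]; positivity
  · rw [div_mul_eq_mul_div, le_div_iff₀ hc]
    refine le_of_mul_le_mul_right ?_ h0
    nlinarith

omit [CompleteSpace H] in
theorem comm_of_inverse {S N J : CausalSpace H T →L[ℝ] CausalSpace H T} (h1 : S * (1 + N) = 1)
    (h2 : (1 + N) * S = 1) (hN : Commute J N) : Commute J S := by
  have h3 : Commute J (1 + N) := (Commute.one_right J).add_right hN
  calc J * S = S * (1 + N) * (J * S) := by rw [h1, one_mul]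
    _ = S * ((1 + N) * J) * S := by simp only [mul_assoc]
    _ = S * (J * (1 + N)) * S := by rw [h3.eq]
    _ = S * J * ((1 + N) * S) := by simp only [mul_assoc]
    _ = S * J := by rw [h2, mul_one]

theorem commute_integ_lift (A : H →L[ℝ] H) :
    Commute (integ : CausalSpace H T →L[ℝ] CausalSpace H T) (lift A) :=
  ContinuousLinearMap.ext fun u => integ_lift A u

/-- The solution operator of `A u' + Q u = f`, `u(0) = 0`, for a bounded accretive operator `Q`. -/
theorem exists_solutionOperator_of_bounded (hT : 0 ≤ T) {A Q : H →L[ℝ] H} {c : ℝ}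
    (hA : IsCoerciveSymm A c) (hc : 0 < c) (hQ : ∀ x, 0 ≤ ⟪Q x, x⟫) :
    ∃ L : CausalSpace H T →L[ℝ] CausalSpace H T, Commute integ L ∧
      (∀ f, ∀ t ∈ Icc 0 T, ‖L f t‖ ≤ 2 / c * ∫ s in (0 : ℝ)..t, ‖f s‖) ∧
      ∀ f, lift A (L f) + lift Q (L (integ f)) = integ f := by
  obtain ⟨A', hA'⟩ := hA.exists_inverse hc
  -- For bounded `Q` the equation is the Volterra equation `(1 + N) u = integ (A⁻¹ f)`.
  let N : CausalSpace H T →L[ℝ] CausalSpace H T := integ * lift (A' ∘L Q)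
  have hcaus : IsCausalOp (lift (A' ∘L Q) : CausalSpace H T →L[ℝ] CausalSpace H T) ‖A' ∘L Q‖ :=
    fun u R t ht hu => by
      rw [lift_apply]
      exact (A' ∘L Q).le_opNorm_of_le (hu t (right_mem_Icc.2 ht.1))
  have hN : IsVolterra N (1 * ‖A' ∘L Q‖) := IsVolterra.of_integral_le hcaus zero_le_one
    fun u t ht => by rw [one_mul]; exact norm_integ_apply_le _ ht
  obtain ⟨S, h1, h2, -⟩ := hN.exists_inverse (by positivity) hT
  let L := S * (integ * lift A')
  have hcomm : Commute integ L :=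
    (comm_of_inverse h1 h2 ((Commute.refl _).mul_right (commute_integ_lift _))).mul_right
      ((Commute.refl _).mul_right (commute_integ_lift _))
  have hL : ∀ f, L f = integ (lift A' (f - lift Q (L f))) := fun f => by
    have h3 : (1 + N) (L f) = integ (lift A' f) := by
      have := congrArg (fun R => R (integ (lift A' f))) h2
      exact this
    have h4 : L f + integ (lift (A' ∘L Q) (L f)) = integ (lift A' f) := h3
    have h5 : lift (A' ∘L Q) (L f) = lift A' (lift Q (L f)) := CausalSpace.ext fun t => by simp
    rw [h5] at h4
    rw [map_sub, map_sub, ← h4, add_sub_cancel_right]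
  have hAL : ∀ f, lift A (L f) = integ (f - lift Q (L f)) := fun f => by
    conv_lhs => rw [hL f]
    rw [← integ_lift]
    congr 1
    exact CausalSpace.ext fun t => by simp [hA']
  refine ⟨L, hcomm, fun f t ht => ?_, fun f => ?_⟩
  -- The bound uses only that `Q` is accretive and does not involve the norm of `Q`, so it survives
  -- the limit of Yosida approximations.
  · rw [hL f]
    refine norm_integ_le_of_inner_nonpos hA hc _ f (fun s _ => ?_) ht
    rw [← hL f]
    simp only [lift_apply, hA', CausalSpace.sub_apply]
    rw [sub_sub_cancel_left, inner_neg_left]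
    linarith [hQ (L f s)]
  · have h3 : L (integ f) = integ (L f) := (congrArg (fun R => R f) hcomm.eq).symm
    rw [hAL, h3, ← integ_lift, map_sub, sub_add_cancel]

/-! ### Skew-adjoint operators by Yosida approximation -/

theorem cauchySeq_of_dense {X Y : Type*} [NormedAddCommGroup X] [NormedSpace ℝ X]
    [NormedAddCommGroup Y] [NormedSpace ℝ Y] {L : ℕ → X →L[ℝ] Y} {C : ℝ} (hL : ∀ n, ‖L n‖ ≤ C)
    {s : Set X} (hs : ∀ x ∈ s, CauchySeq fun n => L n x) {x : X} (hx : x ∈ closure s) :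
    CauchySeq fun n => L n x := by
  have hC : 0 ≤ C := (norm_nonneg _).trans (hL 0)
  rw [Metric.cauchySeq_iff]
  intro ε hε
  obtain ⟨y, hy, hxy⟩ := Metric.mem_closure_iff.1 hx (ε / (3 * (C + 1))) (by positivity)
  obtain ⟨N, hN⟩ := Metric.cauchySeq_iff.1 (hs y hy) (ε / 3) (by positivity)
  refine ⟨N, fun m hm n hn => ?_⟩
  have h1 : ∀ n, dist (L n x) (L n y) < ε / 3 := fun n => by
    rw [dist_eq_norm, ← map_sub]
    rw [dist_eq_norm] at hxy
    calc ‖L n (x - y)‖ ≤ C * ‖x - y‖ := (L n).le_of_opNorm_le (hL n) _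
      _ ≤ (C + 1) * ‖x - y‖ := by gcongr; linarith
      _ < (C + 1) * (ε / (3 * (C + 1))) := by gcongr
      _ = ε / 3 := by field_simp
  have h2 := h1 n
  rw [dist_comm] at h2
  calc _ ≤ dist (L m x) (L m y) + dist (L m y) (L n y) + dist (L n y) (L n x) := dist_triangle4 _ _ _ _
    _ < ε / 3 + ε / 3 + ε / 3 := by
      have := hN m hm n hn
      have := h1 m
      linarith
    _ = ε := by ring

/-- The estimate for the difference of two Yosida approximations. -/
theorem inner_sub_yosida_le {P : H →ₗ.[ℝ] H} (hP : IsSkewAdjoint P) {x y x' y' : H} {r r' G : ℝ}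
    (hr : 0 ≤ r) (hr' : 0 ≤ r') (h : (x, y) ∈ P.graph) (h' : (x', y') ∈ P.graph) (hy : ‖y‖ ≤ G)
    (hy' : ‖y'‖ ≤ G) :
    -⟪y - y', (x + r • y) - (x' + r' • y')⟫ ≤ 2 * G ^ 2 * (r + r') := by
  have h1 : ⟪y - y', x - x'⟫ = 0 := hP.inner_graph (P.graph.sub_mem h h')
  have h2 : (x + r • y) - (x' + r' • y') = (x - x') + (r • y - r' • y') := by abel
  have hG : 0 ≤ G := (norm_nonneg _).trans hy
  rw [h2, inner_add_right, h1, zero_add]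
  have h3 : ‖y - y'‖ ≤ 2 * G := (norm_sub_le _ _).trans (by linarith)
  have h4 : ‖r • y - r' • y'‖ ≤ (r + r') * G := by
    refine (norm_sub_le _ _).trans ?_
    rw [norm_smul, norm_smul, Real.norm_of_nonneg hr, Real.norm_of_nonneg hr', add_mul]
    gcongr
  calc _ ≤ |⟪y - y', r • y - r' • y'⟫| := neg_le_abs _
    _ ≤ ‖y - y'‖ * ‖r • y - r' • y'‖ := abs_real_inner_le_norm _ _
    _ ≤ (2 * G) * ((r + r') * G) := by gcongr
    _ = _ := by ring

omit [CompleteSpace H] in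
theorem norm_le_of_integral_bound {L : CausalSpace H T →L[ℝ] CausalSpace H T} (hT : 0 ≤ T) {C : ℝ}
    (hC : 0 ≤ C) (h : ∀ f, ∀ t ∈ Icc 0 T, ‖L f t‖ ≤ C * ∫ s in (0 : ℝ)..t, ‖f s‖) :
    ‖L‖ ≤ C * T := by
  refine L.opNorm_le_bound (by positivity) fun f => norm_le _ (by positivity) fun t ht =>
    (h f t ht).trans ?_
  have h1 : ∫ s in (0 : ℝ)..t, ‖f s‖ ≤ T * ‖f‖ := by
    calc ∫ s in (0 : ℝ)..t, ‖f s‖ ≤ ∫ s in (0 : ℝ)..t, ‖f‖ :=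
          intervalIntegral.integral_mono_on ht.1 (f.continuous.norm.intervalIntegrable _ _)
            (by simp) fun s _ => f.norm_apply_le s
      _ = t * ‖f‖ := by simp
      _ ≤ _ := by gcongr; exact ht.2
  calc _ ≤ C * (T * ‖f‖) := by gcongr
    _ = _ := by ring

/-- The solution operator of `A u' + P u = f`, `u(0) = 0`, for a skew-adjoint operator `P`. -/
theorem exists_solutionOperator (hT : 0 ≤ T) {P : H →ₗ.[ℝ] H} (hP : IsSkewAdjoint P) {A : H →L[ℝ] H}
    {c : ℝ} (hA : IsCoerciveSymm A c) (hc : 0 < c) :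
    ∃ L : CausalSpace H T →L[ℝ] CausalSpace H T, Commute integ L ∧
      (∀ f, ∀ t ∈ Icc 0 T, ‖L f t‖ ≤ 2 / c * ∫ s in (0 : ℝ)..t, ‖f s‖) ∧
      ∀ f t, (L (integ f) t, integ f t - A (L f t)) ∈ P.graph := by
  let r : ℕ → ℝ := fun n => 1 / ((n : ℝ) + 1)
  have hr : ∀ n, 0 < r n := fun n => Nat.one_div_pos_of_nat
  have hr0 : Tendsto r atTop (𝓝 0) := tendsto_one_div_add_atTop_nhds_zero_nat
  choose J Q hJQ hJQ' _ using fun n => hP.exists_resolvent (hr n)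
  have hQ : ∀ n x, 0 ≤ ⟪Q n x, x⟫ := fun n x => by
    have h1 := hP.inner_graph (hJQ n x)
    have h2 : ⟪Q n x, J n x + r n • Q n x⟫ = r n * ‖Q n x‖ ^ 2 := by
      rw [inner_add_right, inner_smul_right, real_inner_self_eq_norm_sq]
      simp only at h1
      rw [h1, zero_add]
    rw [hJQ'] at h2
    rw [h2]
    have := (hr n).le
    positivity
  choose L hLc hLb hLe using fun n => exists_solutionOperator_of_bounded hT hA hc (hQ n)
  have hLn : ∀ n, ‖L n‖ ≤ 2 / c * T := fun n => norm_le_of_integral_bound hT (by positivity) (hLb n)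
  have hLI : ∀ n f, L n (integ f) = integ (L n f) := fun n f =>
    (congrArg (fun R => R f) (hLc n).eq).symm
  -- For integrated data the equation itself bounds `Q n u` uniformly in `n`, because the term with
  -- the time derivative equals `A (L n f)`.
  have hQb : ∀ f : CausalSpace H T, ∃ G, ∀ n t, ‖Q n (L n (integ f) t)‖ ≤ G := fun f => by
    refine ⟨‖integ f‖ + ‖A‖ * (2 / c * T * ‖f‖), fun n t => ?_⟩
    have h1 := congrArg (fun u : CausalSpace H T => u t) (hLe n f)
    simp only [CausalSpace.add_apply, lift_apply] at h1
    rw [eq_sub_of_add_eq' h1]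
    refine (norm_sub_le _ _).trans (add_le_add (norm_apply_le _ _) ?_)
    exact A.le_opNorm_of_le ((norm_apply_le _ _).trans ((L n).le_of_opNorm_le (hLn n) f))
  -- Convergence is proved first for integrated data, where the difference of two approximations has
  -- energy of order `r m + r n`; density and the uniform bound extend it to all data.
  have hcau : ∀ x ∈ range (integ : CausalSpace H T →L[ℝ] CausalSpace H T),
      CauchySeq fun n => L n x := by
    rintro _ ⟨f, rfl⟩
    obtain ⟨G, hG⟩ := hQb f
    have hest : ∀ m n, c * ‖L m (integ f) - L n (integ f)‖ ^ 2 ≤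
        4 * T * G ^ 2 * (r m + r n) := fun m n => by
      have hnn : 0 ≤ 4 * T * G ^ 2 * (r m + r n) := by
        have := (hr m).le
        have := (hr n).le
        positivity
      have key : ∀ t ∈ Icc 0 T, ‖(L m (integ f) - L n (integ f)) t‖ ≤
          √(4 * T * G ^ 2 * (r m + r n) / c) := fun t ht => by
        have e : integ (L m f - L n f) = L m (integ f) - L n (integ f) := by
          rw [map_sub, hLI, hLI]
        have h1 := energy_le hA.1 (L m f - L n f) (η := fun _ => 2 * G ^ 2 * (r m + r n))
          continuous_const (fun s _ => by
            have h2 := inner_sub_yosida_le hP (hr m).le (hr n).le (hJQ m (L m (integ f) s))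
              (hJQ n (L n (integ f) s)) (hG m s) (hG n s)
            rw [hJQ', hJQ', ← inner_neg_left] at h2
            have h3 := congrArg (fun u : CausalSpace H T => u s) (hLe m f)
            have h4 := congrArg (fun u : CausalSpace H T => u s) (hLe n f)
            simp only [CausalSpace.add_apply, lift_apply] at h3 h4
            rw [e, CausalSpace.sub_apply, CausalSpace.sub_apply, map_sub, eq_sub_of_add_eq h3, eq_sub_of_add_eq h4]
            convert h2 using 2
            abel) ht
        rw [e] at h1
        have h5 := (hA.2 _).trans h1
        rw [intervalIntegral.integral_const, sub_zero, smul_eq_mul] at h5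
        refine Real.le_sqrt_of_sq_le ?_
        rw [le_div_iff₀ hc]
        have h6 : t * (2 * G ^ 2 * (r m + r n)) ≤ T * (2 * G ^ 2 * (r m + r n)) := by
          have := (hr m).le
          have := (hr n).le
          have := ht.2
          gcongr
        linarith
      have h7 := norm_le _ (Real.sqrt_nonneg _) key
      have h8 : ‖L m (integ f) - L n (integ f)‖ ^ 2 ≤ 4 * T * G ^ 2 * (r m + r n) / c := by
        rw [← Real.sq_sqrt (show 0 ≤ 4 * T * G ^ 2 * (r m + r n) / c by positivity)]
        gcongr
      rw [le_div_iff₀ hc] at h8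
      linarith
    rw [Metric.cauchySeq_iff]
    intro ε hε
    have h1 : Tendsto (fun n => 8 * T * G ^ 2 * r n) atTop (𝓝 0) := by
      simpa using hr0.const_mul (8 * T * G ^ 2)
    obtain ⟨N, hN⟩ := (h1.eventually (gt_mem_nhds (show 0 < c * ε ^ 2 by positivity))).exists_forall_of_atTop
    refine ⟨N, fun m hm n hn => ?_⟩
    rw [dist_eq_norm]
    refine lt_of_pow_lt_pow_left₀ 2 hε.le ?_
    refine lt_of_mul_lt_mul_left ?_ hc.le
    have := hest m n
    have := hN m hm
    have := hN n hn
    linarith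
  have hlim : ∀ f, ∃ g, Tendsto (fun n => L n f) atTop (𝓝 g) := fun f =>
    cauchySeq_tendsto_of_complete (cauchySeq_of_dense hLn hcau (by rw [denseRange_integ]; trivial))
  choose L' hL' using hlim
  have happly : ∀ f t, Tendsto (fun n => L n f t) atTop (𝓝 (L' f t)) := fun f t => by
    have h1 : Tendsto (fun n => ‖L n f - L' f‖) atTop (𝓝 0) :=
      tendsto_iff_norm_sub_tendsto_zero.1 (hL' f)
    refine tendsto_iff_norm_sub_tendsto_zero.2 (squeeze_zero (fun _ => norm_nonneg _) (fun n => ?_) h1)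
    exact norm_apply_le (L n f - L' f) t
  refine ⟨continuousLinearMapOfTendsto L (tendsto_pi_nhds.2 hL'), ?_, fun f t ht => ?_, fun f t => ?_⟩
  · refine ContinuousLinearMap.ext fun f => ?_
    refine tendsto_nhds_unique ((integ.continuous.tendsto _).comp (hL' f)) ?_
    refine (hL' (integ f)).congr fun n => hLI n f
  · exact le_of_tendsto' (happly f t).norm fun n => hLb n f t ht
  · obtain ⟨G, hG⟩ := hQb f
    have h1 : ∀ n, Q n (L n (integ f) t) = integ f t - A (L n f t) := fun n => by
      have h2 := congrArg (fun u : CausalSpace H T => u t) (hLe n f)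
      simp only [CausalSpace.add_apply, lift_apply] at h2
      exact eq_sub_of_add_eq' h2
    have h2 : Tendsto (fun n => Q n (L n (integ f) t)) atTop (𝓝 (integ f t - A (L' f t))) := by
      simp only [h1]
      exact tendsto_const_nhds.sub ((A.continuous.tendsto _).comp (happly f t))
    -- The resolvent differs from the identity by `r n • Q n`, which tends to 0 here since `Q n`
    -- converges along these vectors. Closedness of the graph then gives the limit equation.
    have h3 : Tendsto (fun n => J n (L n (integ f) t)) atTop (𝓝 (L' (integ f) t)) := by
      have h4 : ∀ n, J n (L n (integ f) t) = L n (integ f) t - r n • Q n (L n (integ f) t) :=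
        fun n => eq_sub_of_add_eq (hJQ' n _)
      simp only [h4]
      simpa using (happly (integ f) t).sub (hr0.smul h2)
    exact hP.isClosed_graph.mem_of_tendsto (h3.prodMk_nhds h2)
      (Eventually.of_forall fun n => hJQ n _)

/-! ### Causal perturbations, uniqueness and the resolvent identity -/

/-- The solution operator of `A u' + P u + K u = f`, `u(0) = 0`. -/
theorem exists_perturbed_solutionOperator (hT : 0 ≤ T) {P : H →ₗ.[ℝ] H} (hP : IsSkewAdjoint P)
    {A : H →L[ℝ] H} {c : ℝ} (hA : IsCoerciveSymm A c) (hc : 0 < c)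
    {K : CausalSpace H T →L[ℝ] CausalSpace H T} {κ : ℝ} (hκ : 0 ≤ κ) (hK : IsCausalOp K κ)
    (hKI : Commute integ K) :
    ∃ B : CausalSpace H T →L[ℝ] CausalSpace H T, Commute integ B ∧
      (∀ f, ‖B f‖ ≤ Real.exp (2 / c * κ * T) * (2 / c * ∫ s in (0 : ℝ)..T, ‖f s‖)) ∧
      ∀ f t, (integ (B f) t, integ f t - A (B f t) - K (integ (B f)) t) ∈ P.graph := by
  obtain ⟨L, hLI, hLb, hLP⟩ := exists_solutionOperator hT hP hA hc
  -- Duhamel's principle turns the perturbed equation into `(1 + L K) u = L f`.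
  have hN : IsVolterra (L * K) (2 / c * κ) := IsVolterra.of_integral_le hK (by positivity)
    fun u t ht => hLb _ t ht
  obtain ⟨S, h1, h2, hS⟩ := hN.exists_inverse (by positivity) hT
  have hSI : Commute integ S := comm_of_inverse h1 h2 (hLI.mul_right hKI)
  have hBI : Commute integ (S * L) := hSI.mul_right hLI
  refine ⟨S * L, hBI, fun f => ?_, fun f t => ?_⟩
  · refine (S.le_of_opNorm_le hS _).trans ?_
    gcongr
    refine norm_le _ ?_ fun t ht => (hLb f t ht).trans ?_
    · have : 0 ≤ ∫ s in (0 : ℝ)..T, ‖f s‖ :=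
        intervalIntegral.integral_nonneg hT fun _ _ => norm_nonneg _
      positivity
    · gcongr
      exact intervalIntegral.integral_mono_interval le_rfl ht.1 ht.2
        (Eventually.of_forall fun _ => norm_nonneg _) (f.continuous.norm.intervalIntegrable _ _)
  · have h3 : (S * L) f = L (f - K ((S * L) f)) := by
      have h4 : (S * L) f + L (K ((S * L) f)) = L f := congrArg (fun R => R (L f)) h2
      rw [map_sub, ← h4, add_sub_cancel_right]
    have h5 := hLP (f - K ((S * L) f)) t
    rw [← h3] at h5
    have h6 : L (integ (f - K ((S * L) f))) = integ ((S * L) f) := by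
      conv_rhs => rw [h3]
      exact (congrArg (fun R => R (f - K ((S * L) f))) hLI.eq).symm
    have h7 : integ (K ((S * L) f)) = K (integ ((S * L) f)) :=
      congrArg (fun R => R ((S * L) f)) hKI.eq
    rw [h6, map_sub, h7, CausalSpace.sub_apply, sub_right_comm] at h5
    exact h5

/-- Uniqueness of causal solutions up to time `T`. -/
theorem eq_zero_of_mem_graph {P : H →ₗ.[ℝ] H} (hP : IsSkewAdjoint P)
    {A : H →L[ℝ] H} {c : ℝ} (hA : IsCoerciveSymm A c) (hc : 0 < c)
    {K : CausalSpace H T →L[ℝ] CausalSpace H T} {κ : ℝ} (hκ : 0 ≤ κ) (hK : IsCausalOp K κ)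
    {y : CausalSpace H T}
    (hy : ∀ t ∈ Icc 0 T, (integ y t, -A (y t) - K (integ y) t) ∈ P.graph) : y = 0 := by
  have h1 : integ y = 0 := by
    refine hK.eq_zero hκ (c := 2 / c) (by positivity) fun t ht => ?_
    have h2 := norm_integ_le_of_inner_nonpos hA hc y (-K (integ y)) (fun s hs => by
      have := hP.inner_graph (hy s hs)
      rw [CausalSpace.neg_apply, sub_neg_eq_add, ← neg_nonneg, ← inner_neg_left]
      simp only at this
      rw [← this]
      exact le_of_eq (by congr 1; abel)) ht
    simpa using h2
  -- With `integ y = 0` the equation reduces to `A y = 0`, and coercivity finishes.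
  refine ext_Icc fun t ht => ?_
  have h2 := hy t ht
  rw [h1, map_zero, CausalSpace.zero_apply, sub_zero] at h2
  obtain ⟨z, hz, hz'⟩ := (LinearPMap.mem_graph_iff P).1 h2
  have hz0 : z = 0 := Subtype.ext hz
  rw [hz0, LinearPMap.map_zero] at hz'
  have h3 := hA.2 (y t)
  have h4 : A (y t) = 0 := by simpa using hz'.symm
  rw [h4, inner_zero_left] at h3
  have h5 : ‖y t‖ ^ 2 ≤ 0 := by nlinarith [sq_nonneg ‖y t‖]
  have h6 : ‖y t‖ = 0 := by nlinarith [norm_nonneg (y t)]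
  simpa using h6

/-- The resolvent identity for two solution operators. -/
theorem resolvent_identity {P : H →ₗ.[ℝ] H} (hP : IsSkewAdjoint P)
    {A A' : H →L[ℝ] H} {K K' B B' : CausalSpace H T →L[ℝ] CausalSpace H T} {c κ : ℝ}
    (hA' : IsCoerciveSymm A' c) (hc : 0 < c) (hκ : 0 ≤ κ) (hK' : IsCausalOp K' κ)
    (hKI : Commute integ K')
    (hB : ∀ f t, (integ (B f) t, integ f t - A (B f t) - K (integ (B f)) t) ∈ P.graph)
    (hB' : ∀ f t, (integ (B' f) t, integ f t - A' (B' f t) - K' (integ (B' f)) t) ∈ P.graph)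
    (f : CausalSpace H T) :
    integ (B' f - B f) = -B' (lift (A' - A) (B f) + (K' - K) (integ (B f))) := by
  set z := B' f - B f with hz
  set g := -(lift (A' - A) (B f) + (K' - K) (integ (B f))) with hg
  have h1 : ∀ t, (integ z t, (g - lift A' z - K' (integ z)) t) ∈ P.graph := fun t => by
    have := P.graph.sub_mem (hB' f t) (hB f t)
    convert this using 1
    ext
    · simp [hz]
    · simp [hz, hg]; abel
  -- The right-hand side `g` in `h1` is not integrated, whereas the equation defining `B' g`
  -- contains `integ g`. Integrating once more matches the two; this is the lost integration in the
  -- identity.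
  have h2 := hP.integ_mem_graph h1
  have h3 : integ z - B' g = 0 := by
    refine eq_zero_of_mem_graph hP hA' hc hκ hK' fun t _ => ?_
    have h4 := P.graph.sub_mem (h2 t) (hB' g t)
    convert h4 using 1
    have h5 : integ (K' (integ z)) = K' (integ (integ z)) :=
      congrArg (fun R => R (integ z)) hKI.eq
    ext
    · simp
    · simp [h5, integ_lift]; abel
  rw [← map_neg, ← hg]
  exact sub_eq_zero.1 h3

end Solution

/-! ### Convolution with integrable kernels -/

section Convolution

variable {H 𝔸 : Type*} [NormedAddCommGroup H] [NormedSpace ℝ H]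
  [NormedAddCommGroup 𝔸] [NormedSpace ℝ 𝔸] {T : ℝ}

/-- Half-line convolution `∫_0^∞ q(τ) u(t - τ) dτ`. -/
def convAt (α : 𝔸 →L[ℝ] H →L[ℝ] H) (q : ℝ → 𝔸) (u : ℝ → H) (t : ℝ) : H :=
  ∫ τ in Ici (0 : ℝ), α (q τ) (u (t - τ))

theorem convAt_congr {α : 𝔸 →L[ℝ] H →L[ℝ] H} {q : ℝ → 𝔸} {u u' : ℝ → H} {t : ℝ}
    (h : ∀ s ≤ t, u s = u' s) : convAt α q u t = convAt α q u' t :=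
  setIntegral_congr_fun measurableSet_Ici fun τ hτ => by
    have h0 : (0 : ℝ) ≤ τ := hτ
    simp only [h (t - τ) (by linarith)]

variable (α : 𝔸 →L[ℝ] H →L[ℝ] H) (q : Lp 𝔸 1 (volume.restrict (Ici (0 : ℝ)))) (u : CausalSpace H T)

theorem norm_conv_integrand_le (τ s : ℝ) : ‖α (q τ) (u s)‖ ≤ ‖α‖ * ‖q τ‖ * ‖u‖ :=
  (α.le_opNorm₂ _ _).trans (by gcongr; exact u.norm_apply_le s)

theorem aestronglyMeasurable_conv_integrand (t : ℝ) :
    AEStronglyMeasurable (fun τ => α (q τ) (u (t - τ))) (volume.restrict (Ici (0 : ℝ))) := by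
  have h1 : AEStronglyMeasurable (fun τ => u (t - τ)) (volume.restrict (Ici (0 : ℝ))) :=
    (u.continuous.comp (continuous_const.sub continuous_id)).aestronglyMeasurable
  exact isBoundedBilinearMap_apply.continuous.comp_aestronglyMeasurable₂
    (α.continuous.comp_aestronglyMeasurable (Lp.aestronglyMeasurable q)) h1

theorem integrable_norm_kernel (C : ℝ) :
    Integrable (fun τ => ‖α‖ * ‖q τ‖ * C) (volume.restrict (Ici (0 : ℝ))) :=
  ((L1.integrable_coeFn q).norm.const_mul _).mul_const _

theorem integrable_conv_integrand (t : ℝ) :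
    Integrable (fun τ => α (q τ) (u (t - τ))) (volume.restrict (Ici (0 : ℝ))) :=
  (integrable_norm_kernel α q ‖u‖).mono' (aestronglyMeasurable_conv_integrand α q u t)
    (Eventually.of_forall fun τ => norm_conv_integrand_le α q u τ _)

theorem continuous_convAt : Continuous (convAt α q u) := by
  refine continuous_of_dominated (fun t => aestronglyMeasurable_conv_integrand α q u t)
    (fun t => Eventually.of_forall fun τ => norm_conv_integrand_le α q u τ _)
    (integrable_norm_kernel α q ‖u‖) (Eventually.of_forall fun τ => ?_)
  exact (α (q τ)).continuous.comp (u.continuous.comp (continuous_id.sub continuous_const))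

theorem norm_convAt_le {R t : ℝ} (hR : 0 ≤ R) (h : ∀ s ∈ Icc 0 t, ‖u s‖ ≤ R) :
    ‖convAt α q u t‖ ≤ ‖α‖ * ‖q‖ * R := by
  have h1 : ‖convAt α q u t‖ ≤ ∫ τ in Ici (0 : ℝ), ‖α‖ * ‖q τ‖ * R := by
    refine norm_integral_le_of_norm_le (integrable_norm_kernel α q R) ?_
    filter_upwards [ae_restrict_mem measurableSet_Ici] with τ hτ
    have h0 : (0 : ℝ) ≤ τ := hτ
    refine (α.le_opNorm₂ _ _).trans ?_
    gcongr
    rcases le_total (t - τ) 0 with h2 | h2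
    · rw [u.apply_nonpos h2]; simpa using hR
    · exact h _ ⟨h2, by linarith⟩
  rwa [integral_mul_const, integral_const_mul, ← L1.norm_eq_integral_norm] at h1

theorem convAt_nonpos {t : ℝ} (ht : t ≤ 0) : convAt α q u t = 0 := by
  refine setIntegral_eq_zero_of_forall_eq_zero fun τ hτ => ?_
  have h0 : (0 : ℝ) ≤ τ := hτ
  rw [u.apply_nonpos (by linarith), map_zero]

/-- Convolution as a continuous bilinear map. -/
def conv (α : 𝔸 →L[ℝ] H →L[ℝ] H) :
    Lp 𝔸 1 (volume.restrict (Ici (0 : ℝ))) →L[ℝ] CausalSpace H T →L[ℝ] CausalSpace H T :=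
  LinearMap.mkContinuous₂
    (LinearMap.mk₂ ℝ (fun q u => truncate T (convAt α q u) (continuous_convAt α q u)
        fun _ ht => convAt_nonpos α q u ht)
      (fun q q' u => CausalSpace.ext fun t => by
        rw [CausalSpace.add_apply, truncate_apply, truncate_apply, truncate_apply, convAt, convAt, convAt,
          ← integral_add (integrable_conv_integrand α q u _) (integrable_conv_integrand α q' u _)]
        refine integral_congr_ae ?_
        filter_upwards [Lp.coeFn_add q q'] with τ hτ
        simp only [hτ, Pi.add_apply, map_add, add_apply])
      (fun c q u => CausalSpace.ext fun t => by
        rw [CausalSpace.smul_apply, truncate_apply, truncate_apply, convAt, convAt, ← integral_smul]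
        refine integral_congr_ae ?_
        filter_upwards [Lp.coeFn_smul c q] with τ hτ
        simp only [hτ, Pi.smul_apply, map_smul, smul_apply])
      (fun q u u' => CausalSpace.ext fun t => by
        rw [CausalSpace.add_apply, truncate_apply, truncate_apply, truncate_apply, convAt, convAt, convAt,
          ← integral_add (integrable_conv_integrand α q u _) (integrable_conv_integrand α q u' _)]
        simp)
      (fun c q u => CausalSpace.ext fun t => by
        rw [CausalSpace.smul_apply, truncate_apply, truncate_apply, convAt, convAt, ← integral_smul]
        simp))
    ‖α‖ fun q u => norm_le _ (by positivity) fun t _ =>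
      norm_convAt_le α q u (norm_nonneg _) fun s _ => u.norm_apply_le s

variable {α q u}

theorem conv_apply {t : ℝ} (ht : t ≤ T) : conv α q u t = convAt α q u t :=
  truncate_apply_of_le (continuous_convAt α q u) (fun _ ht => convAt_nonpos α q u ht) ht

theorem isCausalOp_conv : IsCausalOp (conv α q : CausalSpace H T →L[ℝ] CausalSpace H T)
    (‖α‖ * ‖q‖) := fun u R t ht hu => by
  rw [conv_apply ht.2]
  exact norm_convAt_le α q u ((norm_nonneg _).trans (hu t (right_mem_Icc.2 ht.1))) hu

theorem isCausalOp_lift {A : H →L[ℝ] H} :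
    IsCausalOp (lift A : CausalSpace H T →L[ℝ] CausalSpace H T) ‖A‖ := fun u R t ht hu => by
  rw [lift_apply]
  exact A.le_opNorm_of_le (hu t (right_mem_Icc.2 ht.1))

theorem _root_.SymmHyp.CausalSpace.IsCausalOp.add
    {K K' : CausalSpace H T →L[ℝ] CausalSpace H T} {κ κ' : ℝ}
    (h : IsCausalOp K κ) (h' : IsCausalOp K' κ') : IsCausalOp (K + K') (κ + κ') :=
  fun u R t ht hu => by
    rw [add_mul]
    exact (norm_add_le _ _).trans (add_le_add (h u R t ht hu) (h' u R t ht hu))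

/-- Convolution commutes with integration. -/
theorem commute_integ_conv [CompleteSpace H] :
    Commute integ (conv α q : CausalSpace H T →L[ℝ] CausalSpace H T) := by
  refine ContinuousLinearMap.ext fun u => ext_Icc fun t ht => ?_
  change integ (conv α q u) t = conv α q (integ u) t
  rw [conv_apply ht.2, integ_apply _ ht.2, convAt]
  have h1 : ∫ s in (0 : ℝ)..t, conv α q u s = ∫ s in (0 : ℝ)..t, convAt α q u s :=
    intervalIntegral.integral_congr fun s hs => by
      rw [uIcc_of_le ht.1] at hs
      exact conv_apply (hs.2.trans ht.2)
  -- Fubini exchanges the two integrals; the shift by `τ` is harmless because `u` vanishes at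
  -- negative times.
  have h2 : Integrable (Function.uncurry fun s τ => α (q τ) (u (s - τ)))
      ((volume.restrict (Ioc 0 t)).prod (volume.restrict (Ici (0 : ℝ)))) := by
    refine ((integrable_norm_kernel α q ‖u‖).comp_snd (volume.restrict (Ioc 0 t))).mono' ?_
      (Eventually.of_forall fun z => norm_conv_integrand_le α q u z.2 _)
    have h3 : AEStronglyMeasurable (fun z : ℝ × ℝ => u (z.1 - z.2))
        ((volume.restrict (Ioc 0 t)).prod (volume.restrict (Ici (0 : ℝ)))) :=
      (u.continuous.comp (continuous_fst.sub continuous_snd)).aestronglyMeasurable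
    exact isBoundedBilinearMap_apply.continuous.comp_aestronglyMeasurable₂
      (α.continuous.comp_aestronglyMeasurable (Lp.aestronglyMeasurable q).comp_snd) h3
  rw [h1, intervalIntegral.integral_of_le ht.1]
  simp only [convAt]
  rw [integral_integral_swap h2]
  refine setIntegral_congr_fun measurableSet_Ici fun τ hτ => ?_
  have h0 : (0 : ℝ) ≤ τ := hτ
  have hi : ∀ a b, IntervalIntegrable u volume a b := fun a b => u.continuous.intervalIntegrable _ _
  have hi' : IntervalIntegrable (fun s => u (s - τ)) volume 0 t :=
    (u.continuous.comp (continuous_id.sub continuous_const)).intervalIntegrable _ _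
  have hz : ∫ s in (-τ)..0, u s = 0 := by
    rw [intervalIntegral.integral_symm, primitive_nonpos (fun t ht => u.apply_nonpos ht)
      (by linarith), neg_zero]
  change ∫ s in Ioc 0 t, α (q τ) (u (s - τ)) = α (q τ) (integ u (t - τ))
  rw [← intervalIntegral.integral_of_le ht.1, (α (q τ)).intervalIntegral_comp_comm hi',
    integ_apply _ (by linarith [ht.2]), intervalIntegral.integral_comp_sub_right (fun s => u s),
    zero_sub, ← intervalIntegral.integral_add_adjacent_intervals (hi (-τ) 0) (hi 0 (t - τ)), hz,
    zero_add]

end Convolution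

/-! ### Dependence of the solution on the coefficients -/

section Coefficients

variable {H 𝔸 𝔹 : Type u} [NormedAddCommGroup H] [InnerProductSpace ℝ H] [CompleteSpace H]
  [NormedAddCommGroup 𝔸] [NormedSpace ℝ 𝔸] [NormedAddCommGroup 𝔹] [NormedSpace ℝ 𝔹] {T : ℝ}

/-- Triples of coefficients that act by `α` and `β` on `H`. -/
abbrev Triple (𝔸 𝔹 : Type*) [NormedAddCommGroup 𝔸] [NormedAddCommGroup 𝔹] : Type _ :=
  𝔸 × 𝔹 × Lp 𝔸 1 (volume.restrict (Ici (0 : ℝ)))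

/-- The operator `u ↦ b u + q * u`. -/
def lowerOrder (T : ℝ) (α : 𝔸 →L[ℝ] H →L[ℝ] H) (β : 𝔹 →L[ℝ] H →L[ℝ] H) :
    Triple 𝔸 𝔹 →L[ℝ] CausalSpace H T →L[ℝ] CausalSpace H T :=
  lift ∘L β ∘L ContinuousLinearMap.fst ℝ _ _ ∘L ContinuousLinearMap.snd ℝ _ _ +
    conv α ∘L ContinuousLinearMap.snd ℝ _ _ ∘L ContinuousLinearMap.snd ℝ _ _

/-- The operator `y ↦ a y + b ∫ y + q * ∫ y`. -/
def fullOp (T : ℝ) (α : 𝔸 →L[ℝ] H →L[ℝ] H) (β : 𝔹 →L[ℝ] H →L[ℝ] H) :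
    Triple 𝔸 𝔹 →L[ℝ] CausalSpace H T →L[ℝ] CausalSpace H T :=
  lift ∘L α ∘L ContinuousLinearMap.fst ℝ _ _ +
    (ContinuousLinearMap.compL ℝ _ _ _).flip integ ∘L lowerOrder T α β

variable {α : 𝔸 →L[ℝ] H →L[ℝ] H} {β : 𝔹 →L[ℝ] H →L[ℝ] H} {P : H →ₗ.[ℝ] H}

omit [CompleteSpace H] in
theorem lowerOrder_apply (w : Triple 𝔸 𝔹) :
    lowerOrder T α β w = lift (β w.2.1) + conv α w.2.2 := rfl

omit [CompleteSpace H] in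
theorem fullOp_apply (w : Triple 𝔸 𝔹) (y : CausalSpace H T) :
    fullOp T α β w y = lift (α w.1) y + lowerOrder T α β w (integ y) := rfl

theorem commute_integ_lowerOrder (w : Triple 𝔸 𝔹) : Commute integ (lowerOrder T α β w) :=
  (commute_integ_lift _).add_right commute_integ_conv

omit [CompleteSpace H] in
theorem isCausalOp_lowerOrder (w : Triple 𝔸 𝔹) :
    IsCausalOp (lowerOrder T α β w) (‖β‖ * ‖w‖ + ‖α‖ * ‖w‖) := by
  intro u R t ht hu
  refine ((isCausalOp_lift.add isCausalOp_conv) u R t ht hu).trans ?_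
  have hR : 0 ≤ R := (norm_nonneg _).trans (hu t (right_mem_Icc.2 ht.1))
  have h1 : ‖w.2.1‖ ≤ ‖w‖ := (norm_fst_le w.2).trans (norm_snd_le w)
  have h2 : ‖w.2.2‖ ≤ ‖w‖ := (norm_snd_le w.2).trans (norm_snd_le w)
  gcongr
  · exact β.le_opNorm_of_le h1
  · exact h2

/-- The coefficients with a coercive leading part. -/
def coerciveSet (α : 𝔸 →L[ℝ] H →L[ℝ] H) : Set (Triple 𝔸 𝔹) :=
  {w | ∃ c > 0, IsCoerciveSymm (α w.1) c}

-- Half of the lower bound absorbs a perturbation of `α w.1` whose operator norm is below `c / 2`;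
-- symmetry holds for all coefficients.
omit [CompleteSpace H] [NormedSpace ℝ 𝔹] in
theorem eventually_coercive (hα : ∀ a x y, ⟪α a x, y⟫ = ⟪x, α a y⟫) {w : Triple 𝔸 𝔹} {c : ℝ}
    (hc : 0 < c) (hw : IsCoerciveSymm (α w.1) c) :
    ∀ᶠ w' in 𝓝 w, IsCoerciveSymm (α w'.1) (c / 2) := by
  have h1 : Tendsto (fun w' : Triple 𝔸 𝔹 => ‖α (w.1 - w'.1)‖) (𝓝 w) (𝓝 0) := by
    have : Continuous fun w' : Triple 𝔸 𝔹 => ‖α (w.1 - w'.1)‖ := by fun_prop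
    simpa using this.tendsto w
  filter_upwards [h1.eventually (gt_mem_nhds (half_pos hc))] with w' hw'
  refine ⟨hα _, fun x => ?_⟩
  have h2 : ⟪α (w.1 - w'.1) x, x⟫ ≤ c / 2 * ‖x‖ ^ 2 := by
    calc _ ≤ ‖α (w.1 - w'.1) x‖ * ‖x‖ := real_inner_le_norm _ _
      _ ≤ (c / 2 * ‖x‖) * ‖x‖ := by
          gcongr
          exact (α (w.1 - w'.1)).le_of_opNorm_le hw'.le x
      _ = _ := by ring
  rw [map_sub, sub_apply, inner_sub_left] at h2
  linarith [hw.2 x]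

omit [CompleteSpace H] [NormedSpace ℝ 𝔹] in
theorem isOpen_coerciveSet (hα : ∀ a x y, ⟪α a x, y⟫ = ⟪x, α a y⟫) :
    IsOpen (coerciveSet α : Set (Triple 𝔸 𝔹)) :=
  isOpen_iff_mem_nhds.2 fun _ ⟨_, hc, hw⟩ =>
    (eventually_coercive hα hc hw).mono fun _ h => ⟨_, half_pos hc, h⟩

/-- `B` maps `f` to the derivative of the solution of `A u' + P u + K u = ∫ f`. -/
def IsSolutionOp (P : H →ₗ.[ℝ] H) (A : H →L[ℝ] H)
    (K B : CausalSpace H T →L[ℝ] CausalSpace H T) : Prop :=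
  ∀ f t, (integ (B f) t, integ f t - A (B f t) - K (integ (B f)) t) ∈ P.graph

theorem IsSolutionOp.unique (hP : IsSkewAdjoint P) {w : Triple 𝔸 𝔹} {c : ℝ}
    (hA : IsCoerciveSymm (α w.1) c) (hc : 0 < c) {B B' : CausalSpace H T →L[ℝ] CausalSpace H T}
    (hB : IsSolutionOp P (α w.1) (lowerOrder T α β w) B)
    (hB' : IsSolutionOp P (α w.1) (lowerOrder T α β w) B') : B = B' := by
  refine ContinuousLinearMap.ext fun f => sub_eq_zero.1 ?_
  refine eq_zero_of_mem_graph hP hA hc (by positivity) (isCausalOp_lowerOrder (α := α) (β := β) w)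
    fun t _ => ?_
  convert P.graph.sub_mem (hB f t) (hB' f t) using 1
  ext
  · simp
  · simp; abel

/-- The constant depends on `w` only through the lower bound `c` and the norm bound `r`, so it is
locally uniform in `w`. The integral on the right is the L¹ norm in time. -/
theorem exists_isSolutionOp (hT : 0 ≤ T) (hP : IsSkewAdjoint P) {w : Triple 𝔸 𝔹} {c : ℝ}
    (hA : IsCoerciveSymm (α w.1) c) (hc : 0 < c) {r : ℝ} (hr : ‖w‖ ≤ r) :
    ∃ B : CausalSpace H T →L[ℝ] CausalSpace H T, Commute integ B ∧
      (∀ f, ‖B f‖ ≤ Real.exp (2 / c * (‖β‖ * r + ‖α‖ * r) * T) * (2 / c) *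
        ∫ s in (0 : ℝ)..T, ‖f s‖) ∧
      IsSolutionOp P (α w.1) (lowerOrder T α β w) B := by
  have hr0 : 0 ≤ r := (norm_nonneg _).trans hr
  have hK : IsCausalOp (lowerOrder T α β w) (‖β‖ * r + ‖α‖ * r) := fun u R t ht hu => by
    have hR : 0 ≤ R := (norm_nonneg _).trans (hu t (right_mem_Icc.2 ht.1))
    refine (isCausalOp_lowerOrder w u R t ht hu).trans ?_
    gcongr
  obtain ⟨B, h1, h2, h3⟩ := exists_perturbed_solutionOperator hT hP hA hc
    (by positivity) hK (commute_integ_lowerOrder w)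
  exact ⟨B, h1, fun f => (h2 f).trans_eq (by ring), h3⟩

/-- The data `h n` form a Cauchy sequence in L¹ in time, with a limit `g` that need not be
continuous and whose primitive is `φ`. By the L¹ bound, `B w (h n)` converges uniformly in time; its
limit `v w` plays the role of `B w g`, and the identities pass to the limit. -/
theorem exists_lossyFamily (hT : 0 ≤ T) (hP : IsSkewAdjoint P)
    (hα : ∀ a x y, ⟪α a x, y⟫ = ⟪x, α a y⟫) {h : ℕ → CausalSpace H T}
    (hh : ∀ ε > 0, ∃ N, ∀ m ≥ N, ∀ n ≥ N, ∫ s in (0 : ℝ)..T, ‖(h m - h n) s‖ < ε)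
    {φ : CausalSpace H T} (hφ : Tendsto (fun n => integ (h n)) atTop (𝓝 φ)) :
    ∃ (B : Triple 𝔸 𝔹 → CausalSpace H T →L[ℝ] CausalSpace H T) (v : Triple 𝔸 𝔹 → CausalSpace H T),
      LossyFamily (coerciveSet α) integ (fullOp T α β) B v ∧
      (∀ w ∈ coerciveSet α, IsSolutionOp P (α w.1) (lowerOrder T α β w) (B w)) ∧
      ∀ w ∈ coerciveSet α, integ (v w) = B w φ := by
  have hex : ∀ w ∈ (coerciveSet α : Set (Triple 𝔸 𝔹)),
      ∃ B : CausalSpace H T →L[ℝ] CausalSpace H T, Commute integ B ∧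
        IsSolutionOp P (α w.1) (lowerOrder T α β w) B := fun w ⟨c, hc, hw⟩ => by
    obtain ⟨B, h1, -, h3⟩ := exists_isSolutionOp hT hP hw hc (β := β) le_rfl
    exact ⟨B, h1, h3⟩
  choose! B hBI hB using hex
  have hcomm : ∀ w ∈ (coerciveSet α : Set (Triple 𝔸 𝔹)), ∀ x, integ (B w x) = B w (integ x) :=
    fun w hw x => congrArg (fun R => R x) (hBI w hw).eq
  have hloc : ∀ w ∈ (coerciveSet α : Set (Triple 𝔸 𝔹)), ∃ C, 0 ≤ C ∧ ∀ᶠ w' in 𝓝 w, ∀ f,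
      ‖B w' f‖ ≤ C * ∫ s in (0 : ℝ)..T, ‖f s‖ := fun w ⟨c, hc, hw⟩ => by
    refine ⟨Real.exp (2 / (c / 2) * (‖β‖ * (‖w‖ + 1) + ‖α‖ * (‖w‖ + 1)) * T) * (2 / (c / 2)),
      by positivity, ?_⟩
    have hn : ∀ᶠ w' in 𝓝 w, ‖w'‖ ≤ ‖w‖ + 1 :=
      (continuous_norm.tendsto w).eventually (ge_mem_nhds (lt_add_one _))
    filter_upwards [hn, eventually_coercive hα hc hw] with w' h1 h2 f
    obtain ⟨B', -, h4, h5⟩ := exists_isSolutionOp hT hP h2 (half_pos hc) (β := β) h1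
    -- The operators `B w` were chosen without estimates; uniqueness identifies them with ones that
    -- obey the bound.
    rw [IsSolutionOp.unique hP h2 (half_pos hc) (hB w' ⟨_, half_pos hc, h2⟩) h5]
    exact h4 f
  have hbdd : ∀ w ∈ (coerciveSet α : Set (Triple 𝔸 𝔹)), ∃ C, ∀ᶠ w' in 𝓝 w, ‖B w'‖ ≤ C :=
    fun w hw => by
      obtain ⟨C, hC0, hC⟩ := hloc w hw
      refine ⟨C * T, hC.mono fun w' hw' => ?_⟩
      refine (B w').opNorm_le_bound (by positivity) fun f => (hw' f).trans ?_
      rw [mul_assoc]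
      gcongr
      calc ∫ s in (0 : ℝ)..T, ‖f s‖ ≤ ∫ s in (0 : ℝ)..T, ‖f‖ :=
            intervalIntegral.integral_mono_on hT (f.continuous.norm.intervalIntegrable _ _)
              (by simp) fun s _ => f.norm_apply_le s
        _ = T * ‖f‖ := by simp
  have hres : ∀ w ∈ (coerciveSet α : Set (Triple 𝔸 𝔹)), ∀ w' ∈ (coerciveSet α : Set (Triple 𝔸 𝔹)),
      ∀ x, integ (B w' x - B w x) = -B w' (fullOp T α β (w' - w) (B w x)) :=
    fun w hw w' hw' x => by
      obtain ⟨c, hc, hA'⟩ := hw'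
      rw [resolvent_identity hP hA' hc (by positivity) (isCausalOp_lowerOrder w')
        (commute_integ_lowerOrder w') (hB w hw) (hB w' ⟨c, hc, hA'⟩) x, fullOp_apply,
        map_sub (lowerOrder T α β), Prod.fst_sub, map_sub α]
  have hlim : ∀ w ∈ (coerciveSet α : Set (Triple 𝔸 𝔹)), ∃ v, Tendsto (fun n => B w (h n)) atTop (𝓝 v) :=
    fun w hw => by
      obtain ⟨C, hC0, hC⟩ := hloc w hw
      refine cauchySeq_tendsto_of_complete (Metric.cauchySeq_iff.2 fun ε hε => ?_)
      obtain ⟨N, hN⟩ := hh (ε / (C + 1)) (by positivity)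
      refine ⟨N, fun m hm n hn => ?_⟩
      rw [dist_eq_norm, ← map_sub]
      have h1 : 0 ≤ ∫ s in (0 : ℝ)..T, ‖(h m - h n) s‖ :=
        intervalIntegral.integral_nonneg hT fun _ _ => norm_nonneg _
      calc _ ≤ C * ∫ s in (0 : ℝ)..T, ‖(h m - h n) s‖ := hC.self_of_nhds _
        _ ≤ (C + 1) * ∫ s in (0 : ℝ)..T, ‖(h m - h n) s‖ := by gcongr; linarith
        _ < (C + 1) * (ε / (C + 1)) := by gcongr; exact hN m hm n hn
        _ = ε := by field_simp
  choose! v hv using hlim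
  have hopen := isOpen_coerciveSet (𝔹 := 𝔹) hα
  refine ⟨B, v, ⟨hcomm, fun w x => ?_, hbdd, hres, fun w hw => ?_, fun w hw => ?_,
    fun w hw w' hw' => ?_⟩, hB, fun w hw => ?_⟩
  · rw [fullOp_apply, fullOp_apply, map_add, integ_lift]
    exact congrArg _ (congrArg (fun R => R (integ x)) (commute_integ_lowerOrder w).eq)
  -- The vector `v` is a locally uniform limit of `w ↦ B w (h N)`, and these are continuous by
  -- strong continuity of `B`.
  · refine continuousWithinAt_of_locally_uniform_approx_of_continuousWithinAt hw fun U hU => ?_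
    obtain ⟨ε, hε, hεU⟩ := Metric.mem_uniformity_dist.1 hU
    obtain ⟨C, hC0, hC⟩ := hloc w hw
    obtain ⟨N, hN⟩ := hh (ε / (2 * (C + 1))) (by positivity)
    refine ⟨_, inter_mem (nhdsWithin_le_nhds hC) self_mem_nhdsWithin, fun w => B w (h N), ?_, ?_⟩
    · refine (tendsto_apply_of_resolvent hopen hcomm hbdd hres hw ?_).mono_left nhdsWithin_le_nhds
      rw [denseRange_integ]
      trivial
    · rintro w' ⟨h1, h2⟩
      refine hεU (lt_of_le_of_lt ?_ (half_lt_self hε))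
      refine le_of_tendsto ((hv w' h2).dist tendsto_const_nhds) ?_
      filter_upwards [eventually_ge_atTop N] with n hn
      rw [dist_eq_norm, ← map_sub]
      have h3 : 0 ≤ ∫ s in (0 : ℝ)..T, ‖(h n - h N) s‖ :=
        intervalIntegral.integral_nonneg hT fun _ _ => norm_nonneg _
      calc _ ≤ C * ∫ s in (0 : ℝ)..T, ‖(h n - h N) s‖ := h1 _
        _ ≤ (C + 1) * ∫ s in (0 : ℝ)..T, ‖(h n - h N) s‖ := by gcongr; linarith
        _ ≤ (C + 1) * (ε / (2 * (C + 1))) := by gcongr; exact (hN n hn N le_rfl).le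
        _ = ε / 2 := by field_simp
  · rw [denseRange_integ]
    trivial
  · have h1 := (integ.continuous.tendsto _).comp ((hv w' hw').sub (hv w hw))
    have h2 : Continuous fun x => -B w' (fullOp T α β (w' - w) x) := by fun_prop
    refine tendsto_nhds_unique h1 (((h2.tendsto _).comp (hv w hw)).congr fun n => ?_)
    exact (hres w hw w' hw' (h n)).symm
  · refine tendsto_nhds_unique ((integ.continuous.tendsto _).comp (hv w hw)) ?_
    refine (((B w).continuous.tendsto _).comp hφ).congr fun n => ?_
    exact (hcomm w hw (h n)).symm

/-- The time derivative of the solution depends smoothly on the coefficients. -/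
theorem exists_solution_contDiffOn (hT : 0 ≤ T) (hP : IsSkewAdjoint P)
    (hα : ∀ a x y, ⟪α a x, y⟫ = ⟪x, α a y⟫) {h : ℕ → CausalSpace H T}
    (hh : ∀ ε > 0, ∃ N, ∀ m ≥ N, ∀ n ≥ N, ∫ s in (0 : ℝ)..T, ‖(h m - h n) s‖ < ε)
    {φ : CausalSpace H T} (hφ : Tendsto (fun n => integ (h n)) atTop (𝓝 φ)) (j : ℕ) :
    ∃ y : Triple 𝔸 𝔹 → CausalSpace H T, ContDiffOn ℝ ((j + 1 : ℕ) : WithTop ℕ∞) y (coerciveSet α) ∧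
      ∀ w ∈ coerciveSet α, ∀ t, (integ (y w) t, (integ ^ (j + 1)) φ t - α w.1 (y w t) -
        lowerOrder T α β w (integ (y w)) t) ∈ P.graph := by
  obtain ⟨B, v, h1, h2, h3⟩ := exists_lossyFamily (𝔹 := 𝔹) (β := β) hT hP hα hh hφ
  refine ⟨fun w => (integ ^ (j + 1)) (v w), h1.contDiffOn (isOpen_coerciveSet hα) (j + 1),
    fun w hw t => ?_⟩
  have hcomm : Commute integ (B w) := ContinuousLinearMap.ext fun x => h1.comm_B w hw x
  -- One integration turns `v w` into `B w φ`, and the other `j` pass through `B w` to the data.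
  have e : (integ ^ (j + 1)) (v w) = B w ((integ ^ j) φ) := by
    rw [pow_succ, mul_apply_eq_comp, h3 w hw]
    exact congrArg (fun R => R φ) (hcomm.pow_left j).eq
  simp only [e]
  rw [pow_succ', mul_apply_eq_comp]
  exact h2 w hw _ t

end Coefficients

/-! ### Causal functions with weak derivatives -/

section WeakDeriv

variable {H : Type*} [NormedAddCommGroup H] [InnerProductSpace ℝ H] [CompleteSpace H]

/-- The primitive that vanishes at `0`. -/
def prim (F : ℝ → H) (t : ℝ) : H := ∫ s in (0 : ℝ)..t, F s

omit [CompleteSpace H] in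
theorem prim_congr {F G : ℝ → H} (h : F =ᵐ[volume] G) : prim F = prim G :=
  funext fun _ => intervalIntegral.integral_congr_ae (h.mono fun _ hx _ => hx)

omit [CompleteSpace H] in
theorem prim_iterate_congr {F G : ℝ → H} (h : F =ᵐ[volume] G) (n : ℕ) :
    prim^[n] F =ᵐ[volume] prim^[n] G := by
  cases n with
  | zero => exact h
  | succ n => rw [Function.iterate_succ_apply, Function.iterate_succ_apply, prim_congr h]

omit [CompleteSpace H] in
theorem prim_nonpos {F : ℝ → H} (h : ∀ᵐ t : ℝ, t < 0 → F t = 0) {t : ℝ} (ht : t ≤ 0) :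
    prim F t = 0 := by
  rw [prim, intervalIntegral.integral_congr_ae (g := fun _ => (0 : H)),
    intervalIntegral.integral_zero]
  filter_upwards [h, Measure.ae_ne volume (0 : ℝ)] with s hs hs0 hst
  rw [uIoc_of_ge ht] at hst
  exact hs (lt_of_le_of_ne hst.2 hs0)

omit [CompleteSpace H] in
theorem continuous_prim {F : ℝ → H} (hF : LocallyIntegrable F) : Continuous (prim F) :=
  intervalIntegral.continuous_primitive
    (fun _ _ => (hF.integrableOn_isCompact isCompact_uIcc).intervalIntegrable) 0

/-- Test functions supported in the negative half-line do not see `F`, hence neither does their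
pairing with `G`. -/
theorem isWeakDeriv_causal {F G : ℝ → H} (hG : LocallyIntegrable G) (h : IsWeakDeriv F G)
    (hF : ∀ᵐ t : ℝ, t < 0 → F t = 0) : ∀ᵐ t : ℝ, t < 0 → G t = 0 := by
  refine isOpen_Iio.ae_eq_zero_of_integral_contDiff_smul_eq_zero
    (hG.locallyIntegrableOn _) fun φ hφ hφc hφs => ?_
  have h1 : ∫ t, deriv φ t • F t = 0 := by
    refine integral_eq_zero_of_ae ?_
    filter_upwards [hF] with t ht
    by_cases h0 : t < 0
    · simp [ht h0]
    · have h2 : t ∉ tsupport φ := fun h3 => h0 (hφs h3)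
      have h3 : deriv φ t = 0 := by
        by_contra h4
        exact h2 (support_deriv_subset h4)
      simp [h3]
  have h2 := h φ hφ hφc
  rw [h1] at h2
  exact neg_eq_zero.1 h2.symm

/-- Fubini on the triangle `0 < s ≤ t ≤ R`. -/
theorem integral_smul_prim {φ : ℝ → ℝ} (hφ : Continuous φ) {G : ℝ → H} (hG : LocallyIntegrable G)
    (R : ℝ) :
    ∫ t in Ioc 0 R, φ t • prim G t = ∫ s in Ioc 0 R, (∫ t in s..R, φ t) • G s := by
  have h1 : IntegrableOn φ (Ioc 0 R) :=
    (hφ.integrableOn_Icc).mono_set Ioc_subset_Icc_self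
  have h2 : IntegrableOn G (Ioc 0 R) :=
    (hG.integrableOn_isCompact isCompact_Icc).mono_set Ioc_subset_Icc_self
  have h3 : Integrable ({z : ℝ × ℝ | z.2 ≤ z.1}.indicator fun z => φ z.1 • G z.2)
      ((volume.restrict (Ioc 0 R)).prod (volume.restrict (Ioc 0 R))) :=
    (Integrable.smul_prod h1 h2).indicator (measurableSet_le measurable_snd measurable_fst)
  have h4 := integral_integral_swap
    (f := fun t s => {z : ℝ × ℝ | z.2 ≤ z.1}.indicator (fun z => φ z.1 • G z.2) (t, s)) h3
  have h5 : ∀ t ∈ Ioc 0 R, ∫ s in Ioc 0 R,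
      {z : ℝ × ℝ | z.2 ≤ z.1}.indicator (fun z => φ z.1 • G z.2) (t, s) = φ t • prim G t := by
    intro t ht
    have e : ∀ s, {z : ℝ × ℝ | z.2 ≤ z.1}.indicator (fun z => φ z.1 • G z.2) (t, s) =
        (Iic t).indicator (fun s => φ t • G s) s := fun s => by
      simp [indicator_apply]
    simp only [e]
    rw [setIntegral_indicator measurableSet_Iic, Ioc_inter_Iic, min_eq_right ht.2, integral_smul,
      prim, intervalIntegral.integral_of_le ht.1.le]
  have h6 : ∀ s ∈ Ioc 0 R, ∫ t in Ioc 0 R,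
      {z : ℝ × ℝ | z.2 ≤ z.1}.indicator (fun z => φ z.1 • G z.2) (t, s) =
        (∫ t in s..R, φ t) • G s := by
    intro s hs
    have e : ∀ t, {z : ℝ × ℝ | z.2 ≤ z.1}.indicator (fun z => φ z.1 • G z.2) (t, s) =
        (Ici s).indicator (fun t => φ t • G s) t := fun t => by
      simp [indicator_apply]
    have e2 : Ioc 0 R ∩ Ici s = Icc s R := by
      ext t
      simp only [mem_inter_iff, mem_Ioc, mem_Ici, mem_Icc]
      constructor
      · rintro ⟨⟨_, h⟩, h'⟩; exact ⟨h', h⟩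
      · rintro ⟨h, h'⟩; exact ⟨⟨hs.1.trans_le h, h'⟩, h⟩
    simp only [e]
    rw [setIntegral_indicator measurableSet_Ici, e2, integral_smul_const,
      integral_Icc_eq_integral_Ioc, intervalIntegral.integral_of_le hs.2]
  rw [setIntegral_congr_fun measurableSet_Ioc h5, setIntegral_congr_fun measurableSet_Ioc h6] at h4
  exact h4

/-- A causal function is the primitive of its weak derivative. -/
theorem eq_prim_of_isWeakDeriv {F G : ℝ → H} (hFi : LocallyIntegrable F) (hG : LocallyIntegrable G)
    (h : IsWeakDeriv F G) (hF : ∀ᵐ t : ℝ, t < 0 → F t = 0) : F =ᵐ[volume] prim G := by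
  have hG0 := isWeakDeriv_causal hG h hF
  refine ae_eq_of_integral_contDiff_smul_eq hFi (continuous_prim hG).locallyIntegrable
    fun φ hφ hφc => ?_
  obtain ⟨R, hR0, hR⟩ : ∃ R : ℝ, 0 < R ∧ ∀ t, R ≤ t → φ t = 0 := by
    obtain ⟨r, hr⟩ := hφc.isCompact.isBounded.subset_closedBall 0
    refine ⟨max (r + 1) 1, by positivity, fun t ht => image_eq_zero_of_notMem_tsupport fun h0 => ?_⟩
    have h1 := hr h0
    rw [mem_closedBall_zero_iff, Real.norm_eq_abs] at h1
    linarith [le_abs_self t, le_max_left (r + 1) 1]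
  have hφ' := hφ.continuous
  have hψd : ∀ t, HasDerivAt (fun t => -∫ r in t..R, φ r) (φ t) t := fun t => by
    have := (intervalIntegral.integral_hasDerivAt_left (hφ'.intervalIntegrable t R)
      hφ'.aestronglyMeasurable.stronglyMeasurableAtFilter hφ'.continuousAt).neg
    rw [neg_neg] at this
    exact this
  have hψ : ContDiff ℝ ∞ fun t => -∫ r in t..R, φ r := by
    rw [contDiff_infty_iff_deriv]
    refine ⟨fun t => (hψd t).differentiableAt, ?_⟩
    rwa [funext fun t => (hψd t).deriv]
  have hψR : ∀ t, R ≤ t → -∫ r in t..R, φ r = 0 := fun t ht => by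
    rw [neg_eq_zero, intervalIntegral.integral_congr (g := fun _ => (0 : ℝ)),
      intervalIntegral.integral_zero]
    intro r hr
    rw [uIcc_of_ge ht] at hr
    exact hR r hr.1
  -- The antiderivative of `φ` that vanishes beyond `R` need not vanish at `-∞`. The cutoff acts
  -- only for `t < -1`, where `F` and `G` are zero, so `θ` is an admissible test function whose
  -- derivative can replace `φ`.
  set θ : ℝ → ℝ := fun t => Real.smoothTransition (t + 2) * -∫ r in t..R, φ r with hθ
  have hθs : ContDiff ℝ ∞ θ :=
    (Real.smoothTransition.contDiff.comp (contDiff_id.add contDiff_const)).mul hψ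
  have hθc : HasCompactSupport θ := by
    refine HasCompactSupport.intro (isCompact_Icc (a := -2) (b := R)) fun t ht => ?_
    rcases lt_or_ge t (-2) with h1 | h1
    · simp [hθ, Real.smoothTransition.zero_of_nonpos (show t + 2 ≤ 0 by linarith)]
    · have h2 : R ≤ t := by
        by_contra h2
        exact ht ⟨h1, by linarith⟩
      rw [hθ]
      simp only [hψR t h2, mul_zero]
  have hθ1 : ∀ t, -1 < t → θ t = -∫ r in t..R, φ r := fun t ht => by
    simp [hθ, Real.smoothTransition.one_of_one_le (show 1 ≤ t + 2 by linarith)]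
  have hθd : ∀ t, 0 ≤ t → deriv θ t = φ t := fun t ht => by
    have : θ =ᶠ[𝓝 t] fun t => -∫ r in t..R, φ r := by
      filter_upwards [lt_mem_nhds (show (-1 : ℝ) < t by linarith)] with r hr using hθ1 r hr
    rw [this.deriv_eq, (hψd t).deriv]
  have e1 : ∫ t, φ t • F t = ∫ t, deriv θ t • F t := by
    refine integral_congr_ae ?_
    filter_upwards [hF] with t ht
    rcases lt_or_ge t 0 with h0 | h0
    · simp [ht h0]
    · rw [hθd t h0]
  have e2 : -∫ t, θ t • G t = ∫ t in Ioc 0 R, (∫ r in t..R, φ r) • G t := by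
    rw [← integral_neg, ← integral_indicator measurableSet_Ioc]
    refine integral_congr_ae ?_
    filter_upwards [hG0, Measure.ae_ne volume (0 : ℝ)] with t ht ht0
    by_cases h1 : t ∈ Ioc 0 R
    · rw [indicator_of_mem h1, hθ1 t (by linarith [h1.1]), neg_smul, neg_neg]
    · rw [indicator_of_notMem h1, neg_eq_zero]
      rcases lt_or_gt_of_ne ht0 with h2 | h2
      · rw [ht h2, smul_zero]
      · have h3 : R ≤ t := by
          by_contra h3
          exact h1 ⟨h2, by linarith⟩
        rw [hθ1 t (by linarith), hψR t h3, zero_smul]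
  have e3 : ∫ t, φ t • prim G t = ∫ t in Ioc 0 R, φ t • prim G t := by
    rw [← integral_indicator measurableSet_Ioc]
    congr 1
    funext t
    by_cases h1 : t ∈ Ioc 0 R
    · rw [indicator_of_mem h1]
    · rw [indicator_of_notMem h1]
      rcases le_or_gt t 0 with h2 | h2
      · rw [prim_nonpos hG0 h2, smul_zero]
      · rw [hR t (le_of_lt (by by_contra h3; exact h1 ⟨h2, by linarith⟩)), zero_smul]
  rw [e1, h θ hθs hθc, e2, e3, integral_smul_prim hφ' hG]

/-- A causal function in `H^s` is an iterated primitive of its weak derivative of order `s`. -/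
theorem MemHs.exists_prim {s : ℕ} {f : ℝ → H} (hf : MemHs s f)
    (hfc : ∀ᵐ t : ℝ, t < 0 → f t = 0) :
    ∃ g : ℝ → H, LocallyIntegrable g ∧ (∀ᵐ t : ℝ, t < 0 → g t = 0) ∧ f =ᵐ[volume] prim^[s] g := by
  obtain ⟨D, hD0, hD, hDw⟩ := hf
  have hli : ∀ j ≤ s, LocallyIntegrable (D j) := fun j hj =>
    (hD j hj).locallyIntegrable (by norm_num)
  have key : ∀ j ≤ s, (∀ᵐ t : ℝ, t < 0 → D j t = 0) ∧ f =ᵐ[volume] prim^[j] (D j) := by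
    intro j
    induction j with
    | zero => intro _; exact ⟨by rwa [hD0], by rw [hD0]; rfl⟩
    | succ j ih =>
      intro hj
      obtain ⟨h1, h2⟩ := ih (by omega)
      refine ⟨isWeakDeriv_causal (hli _ hj) (hDw j hj) h1, h2.trans ?_⟩
      exact prim_iterate_congr (eq_prim_of_isWeakDeriv (hli j (by omega)) (hli _ hj) (hDw j hj) h1) j
  exact ⟨D s, hli s le_rfl, key s le_rfl⟩

omit [CompleteSpace H] in
theorem integ_pow_truncate_apply {T : ℝ} {F : ℝ → H} (hF : Continuous F) (h0 : ∀ t ≤ 0, F t = 0)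
    (n : ℕ) : ∀ t ≤ T, (integ ^ n) (truncate T F hF h0) t = prim^[n] F t := by
  induction n with
  | zero => exact fun t ht => truncate_apply_of_le hF h0 ht
  | succ n ih =>
    intro t ht
    rw [pow_succ', mul_apply_eq_comp, integ_apply _ ht, Function.iterate_succ_apply']
    rcases le_total t 0 with h1 | h1
    · rw [primitive_nonpos (fun r hr => apply_nonpos _ hr) h1]
      rcases lt_or_ge T 0 with hT | hT
      · symm
        refine primitive_nonpos (fun r hr => ?_) h1
        clear ih
        induction n generalizing r with
        | zero => exact h0 r hr
        | succ n ih =>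
          rw [Function.iterate_succ_apply']
          exact primitive_nonpos (fun q hq => ih q hq) hr
      · symm
        refine primitive_nonpos (fun r hr => ?_) h1
        rw [← ih r (hr.trans hT), apply_nonpos _ hr]
    · refine intervalIntegral.integral_congr fun r hr => ?_
      rw [uIcc_of_le h1] at hr
      exact ih r (hr.2.trans ht)

-- Compactly supported continuous functions are dense in L¹, but an element of `CausalSpace` must
-- also vanish at 0. A ramp on `[0, δ]` enforces this at a cost of at most `C δ` in the mean.
omit [CompleteSpace H] in
theorem exists_integral_norm_sub_le {T : ℝ} (hT : 0 < T) {g : ℝ → H} (hg : LocallyIntegrable g)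
    {ε : ℝ} (hε : 0 < ε) : ∃ h : CausalSpace H T, ∫ s in (0 : ℝ)..T, ‖g s - h s‖ ≤ ε := by
  have hgi : IntegrableOn g (Icc 0 T) := hg.integrableOn_isCompact isCompact_Icc
  obtain ⟨k, hkc, hk, hkcont, hki⟩ := Integrable.exists_hasCompactSupport_integral_sub_le
    ((integrable_indicator_iff measurableSet_Icc).2 hgi) (half_pos hε)
  obtain ⟨C, hC⟩ := hkc.exists_bound_of_continuous hkcont
  have hC0 : 0 ≤ C := (norm_nonneg _).trans (hC 0)
  set δ := min T (ε / (2 * (C + 1))) with hδ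
  have hδ0 : 0 < δ := lt_min hT (by positivity)
  have hδT : δ ≤ T := min_le_left _ _
  have hδε : C * δ ≤ ε / 2 := by
    calc C * δ ≤ (C + 1) * (ε / (2 * (C + 1))) := by
          gcongr
          · linarith
          · exact min_le_right _ _
      _ = ε / 2 := by field_simp
  let χ : ℝ → ℝ := fun t => max 0 (min 1 (t / δ))
  have hχ : Continuous χ := by fun_prop
  have hχ1 : ∀ t, |1 - χ t| ≤ 1 := fun t => by
    rw [abs_le]
    have h1 : χ t ≤ 1 := max_le zero_le_one (min_le_left _ _)
    have h2 : 0 ≤ χ t := le_max_left _ _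
    constructor <;> linarith
  have hχ0 : ∀ t ≤ 0, χ t = 0 := fun t ht =>
    max_eq_left ((min_le_right _ _).trans (div_nonpos_of_nonpos_of_nonneg ht hδ0.le))
  have hχδ : ∀ t, δ ≤ t → χ t = 1 := fun t ht => by
    have : 1 ≤ t / δ := (one_le_div hδ0).2 ht
    simp [χ, min_eq_left this]
  have hcont : Continuous fun t => χ t • k t := hχ.smul hkcont
  refine ⟨truncate T _ hcont fun t ht => by simp [hχ0 t ht], ?_⟩
  have hgi' : IntervalIntegrable g volume 0 T :=
    (intervalIntegrable_iff_integrableOn_Icc_of_le hT.le).2 hgi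
  have i1 : IntervalIntegrable (fun s => ‖g s - k s‖) volume 0 T :=
    (hgi'.sub (hkcont.intervalIntegrable _ _)).norm
  have i2 : ∀ a b, IntervalIntegrable (fun s => ‖k s - χ s • k s‖) volume a b := fun a b =>
    (hkcont.sub hcont).norm.intervalIntegrable _ _
  have h1 : ∫ s in (0 : ℝ)..T, ‖g s - k s‖ ≤ ε / 2 := by
    refine le_trans ?_ hk
    rw [intervalIntegral.integral_of_le hT.le]
    have e : ∫ s in Ioc 0 T, ‖g s - k s‖ = ∫ s in Ioc 0 T, ‖(Icc 0 T).indicator g s - k s‖ :=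
      setIntegral_congr_fun measurableSet_Ioc fun s hs => by
        simp only [indicator_of_mem (Ioc_subset_Icc_self hs)]
    rw [e]
    refine setIntegral_le_integral ?_ (Eventually.of_forall fun _ => norm_nonneg _)
    exact (((integrable_indicator_iff measurableSet_Icc).2 hgi).sub hki).norm
  have h2 : ∫ s in (0 : ℝ)..T, ‖k s - χ s • k s‖ ≤ ε / 2 := by
    rw [← intervalIntegral.integral_add_adjacent_intervals (i2 0 δ) (i2 δ T)]
    have e1 : ∫ s in δ..T, ‖k s - χ s • k s‖ = 0 := by
      rw [intervalIntegral.integral_congr (g := fun _ => (0 : ℝ)), intervalIntegral.integral_zero]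
      intro s hs
      rw [uIcc_of_le hδT] at hs
      simp [hχδ s hs.1]
    have e2 : ∫ s in (0 : ℝ)..δ, ‖k s - χ s • k s‖ ≤ ∫ s in (0 : ℝ)..δ, C := by
      refine intervalIntegral.integral_mono_on hδ0.le (i2 _ _) (by simp) fun s _ => ?_
      have e3 : k s - χ s • k s = (1 - χ s) • k s := by rw [sub_smul, one_smul]
      rw [e3, norm_smul, Real.norm_eq_abs]
      calc _ ≤ 1 * C := mul_le_mul (hχ1 s) (hC s) (norm_nonneg _) zero_le_one
        _ = C := one_mul C
    rw [intervalIntegral.integral_const, sub_zero, smul_eq_mul, mul_comm] at e2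
    linarith
  have h3 : ∫ s in (0 : ℝ)..T, ‖g s - truncate T (fun t => χ t • k t) hcont
      (fun t ht => by simp [hχ0 t ht]) s‖ ≤
      ∫ s in (0 : ℝ)..T, (‖g s - k s‖ + ‖k s - χ s • k s‖) := by
    refine intervalIntegral.integral_mono_on hT.le
      (hgi'.sub ((CausalSpace.continuous _).intervalIntegrable _ _)).norm (i1.add (i2 _ _)) fun s hs => ?_
    rw [truncate_apply_of_le _ _ hs.2]
    exact norm_sub_le_norm_sub_add_norm_sub _ _ _
  rw [intervalIntegral.integral_add i1 (i2 _ _)] at h3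
  linarith

omit [CompleteSpace H] in
/-- Causal approximations of an integrable function in the mean. -/
theorem exists_approximation {T : ℝ} (hT : 0 < T) {g : ℝ → H} (hg : LocallyIntegrable g)
    (hg0 : ∀ᵐ t : ℝ, t < 0 → g t = 0) :
    ∃ h : ℕ → CausalSpace H T,
      (∀ ε > 0, ∃ N, ∀ m ≥ N, ∀ n ≥ N, ∫ s in (0 : ℝ)..T, ‖(h m - h n) s‖ < ε) ∧
      Tendsto (fun n => integ (h n)) atTop
        (𝓝 (truncate T (prim g) (continuous_prim hg) fun _ ht => prim_nonpos hg0 ht)) := by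
  choose h hh using fun n : ℕ =>
    exists_integral_norm_sub_le hT hg (ε := 1 / ((n : ℝ) + 1)) Nat.one_div_pos_of_nat
  have hgi : ∀ a b, IntervalIntegrable g volume a b := fun a b =>
    (hg.integrableOn_isCompact isCompact_uIcc).intervalIntegrable
  have hi : ∀ n a b, IntervalIntegrable (fun s => ‖g s - h n s‖) volume a b := fun n a b =>
    ((hgi a b).sub ((h n).continuous.intervalIntegrable _ _)).norm
  have hlim := tendsto_one_div_add_atTop_nhds_zero_nat (𝕜 := ℝ)
  refine ⟨h, fun ε hε => ?_, ?_⟩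
  · obtain ⟨N, hN⟩ := (hlim.eventually (gt_mem_nhds (half_pos hε))).exists_forall_of_atTop
    refine ⟨N, fun m hm n hn => ?_⟩
    have h1 : ∫ s in (0 : ℝ)..T, ‖(h m - h n) s‖ ≤
        ∫ s in (0 : ℝ)..T, (‖g s - h m s‖ + ‖g s - h n s‖) := by
      refine intervalIntegral.integral_mono_on hT.le ((h m - h n).continuous.norm.intervalIntegrable _ _)
        ((hi m _ _).add (hi n _ _)) fun s _ => ?_
      rw [CausalSpace.sub_apply, ← norm_neg (g s - h m s), neg_sub]
      exact norm_sub_le_norm_sub_add_norm_sub _ _ _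
    rw [intervalIntegral.integral_add (hi m _ _) (hi n _ _)] at h1
    have := hh m
    have := hh n
    have := hN m hm
    have := hN n hn
    linarith
  · refine tendsto_iff_norm_sub_tendsto_zero.2 (squeeze_zero (fun _ => norm_nonneg _) (fun n => ?_) hlim)
    refine norm_le _ Nat.one_div_pos_of_nat.le fun t ht => ?_
    rw [CausalSpace.sub_apply, integ_apply _ ht.2, truncate_apply_of_le _ _ ht.2, prim,
      ← intervalIntegral.integral_sub ((h n).continuous.intervalIntegrable _ _) (hgi _ _)]
    refine (intervalIntegral.norm_integral_le_integral_norm ht.1).trans (le_trans ?_ (hh n))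
    simp only [norm_sub_rev (h n _)]
    exact intervalIntegral.integral_mono_interval le_rfl ht.1 ht.2
      (Eventually.of_forall fun _ => norm_nonneg _) (hi n _ _)

end WeakDeriv

/-! ### Causal solutions on the whole line -/

section Global

variable {H 𝔸 𝔹 : Type u} [NormedAddCommGroup H] [InnerProductSpace ℝ H]
  [NormedAddCommGroup 𝔸] [NormedSpace ℝ 𝔸] [NormedAddCommGroup 𝔹] [NormedSpace ℝ 𝔹] {T : ℝ}
  {α : 𝔸 →L[ℝ] H →L[ℝ] H} {β : 𝔹 →L[ℝ] H →L[ℝ] H} {P : H →ₗ.[ℝ] H} {F : ℝ → H}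
  {w : Triple 𝔸 𝔹}

theorem lowerOrder_apply_apply (x : CausalSpace H T) {t : ℝ} (ht : t ≤ T) :
    lowerOrder T α β w x t = β w.2.1 (x t) + convAt α w.2.2 x t := by
  rw [lowerOrder_apply, add_apply, CausalSpace.add_apply, lift_apply, conv_apply ht]

/-- `∫ y` solves the equation with right hand side `F` up to time `T`. -/
def IsSolutionUpTo (P : H →ₗ.[ℝ] H) (α : 𝔸 →L[ℝ] H →L[ℝ] H) (β : 𝔹 →L[ℝ] H →L[ℝ] H) (F : ℝ → H)
    (w : Triple 𝔸 𝔹) (y : CausalSpace H T) : Prop :=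
  ∀ t ≤ T, (integ y t, F t - α w.1 (y t) - lowerOrder T α β w (integ y) t) ∈ P.graph

/-- Causal solutions for a right hand side `F` that is defined everywhere. -/
def IsGlobalSolution (P : H →ₗ.[ℝ] H) (α : 𝔸 →L[ℝ] H →L[ℝ] H) (β : 𝔹 →L[ℝ] H →L[ℝ] H) (F : ℝ → H)
    (w : Triple 𝔸 𝔹) (u : ℝ → GraphSpace P) : Prop :=
  Continuous u ∧ ContDiff ℝ 1 (fun t => GraphSpace.incl P (u t)) ∧ (∀ t < 0, u t = 0) ∧
    ∀ t, α w.1 (deriv (fun τ => GraphSpace.incl P (u τ)) t) + GraphSpace.op P (u t) +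
      β w.2.1 (GraphSpace.incl P (u t)) + convAt α w.2.2 (fun τ => GraphSpace.incl P (u τ)) t = F t

theorem integ_truncate_apply {T' : ℝ} (h : T ≤ T') (y : CausalSpace H T') {t : ℝ} (ht : t ≤ T) :
    integ (truncate T y y.continuous fun _ ht => y.apply_nonpos ht) t = integ y t := by
  rw [integ_apply _ ht, integ_apply _ (ht.trans h)]
  rcases le_total t 0 with h0 | h0
  · rw [primitive_nonpos (fun r hr => apply_nonpos _ hr) h0,
      primitive_nonpos (fun r hr => apply_nonpos _ hr) h0]
  · refine intervalIntegral.integral_congr fun s hs => ?_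
    rw [uIcc_of_le h0] at hs
    exact truncate_apply_of_le _ _ (hs.2.trans ht)

/-- By causality, the equation at times up to `T` involves the values of `y` up to `T` only. -/
theorem IsSolutionUpTo.truncate {T' : ℝ} (h : T ≤ T') {y : CausalSpace H T'}
    (hy : IsSolutionUpTo P α β F w y) :
    IsSolutionUpTo P α β F w (truncate T y y.continuous fun _ ht => y.apply_nonpos ht) := by
  intro t ht
  have h1 := hy t (ht.trans h)
  rw [lowerOrder_apply_apply _ (ht.trans h)] at h1
  rw [lowerOrder_apply_apply _ ht, integ_truncate_apply h y ht, truncate_apply_of_le _ _ ht,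
    convAt_congr fun s hs => integ_truncate_apply h y (hs.trans ht)]
  exact h1

theorem incl_op_eq_of_graph {R : H →L[ℝ] GraphSpace P}
    (hR : ∀ v, R (GraphSpace.incl P v + GraphSpace.op P v) = v) {z : H × H} (hz : z ∈ P.graph) :
    GraphSpace.incl P (R (z.1 + z.2)) = z.1 ∧ GraphSpace.op P (R (z.1 + z.2)) = z.2 := by
  obtain ⟨v, h1, h2⟩ := IsSkewAdjoint.mem_graph_iff_graphSpace.1 hz
  rw [← h1, ← h2, hR]
  exact ⟨rfl, rfl⟩

variable [CompleteSpace H]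

theorem IsSolutionUpTo.unique (hP : IsSkewAdjoint P) (hw : w ∈ coerciveSet α) {y y' : CausalSpace H T}
    (hy : IsSolutionUpTo P α β F w y) (hy' : IsSolutionUpTo P α β F w y') : y = y' := by
  obtain ⟨c, hc, hA⟩ := hw
  refine sub_eq_zero.1 (eq_zero_of_mem_graph hP hA hc (by positivity)
    (isCausalOp_lowerOrder (α := α) (β := β) w) fun t ht => ?_)
  convert P.graph.sub_mem (hy t ht.2) (hy' t ht.2) using 1
  ext
  · simp
  · simp; abel

/-- The derivative of a global solution, truncated at time `T`. -/
theorem IsGlobalSolution.exists_isSolutionUpTo {u : ℝ → GraphSpace P}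
    (hu : IsGlobalSolution P α β F w u) (T : ℝ) :
    ∃ z : CausalSpace H T, IsSolutionUpTo P α β F w z ∧
      ∀ t ≤ T, integ z t = GraphSpace.incl P (u t) := by
  obtain ⟨h1, h2, h3, h4⟩ := hu
  set x : ℝ → H := fun t => GraphSpace.incl P (u t) with hx
  have hd : Continuous (deriv x) := h2.continuous_deriv le_rfl
  have hu0 : ∀ t ≤ 0, u t = 0 := by
    have : IsClosed {t | u t = 0} := isClosed_eq h1 continuous_const
    have h5 : closure (Iio (0 : ℝ)) ⊆ {t | u t = 0} := closure_minimal (fun t ht => h3 t ht) this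
    rw [closure_Iio] at h5
    exact fun t ht => h5 ht
  have hx0 : ∀ t ≤ 0, x t = 0 := fun t ht => by simp [hx, hu0 t ht]
  have hd0 : ∀ t ≤ 0, deriv x t = 0 := by
    have : IsClosed {t | deriv x t = 0} := isClosed_eq hd continuous_const
    have h5 : closure (Iio (0 : ℝ)) ⊆ {t | deriv x t = 0} := by
      refine closure_minimal (fun t ht => ?_) this
      have h6 : x =ᶠ[𝓝 t] fun _ => 0 := by
        filter_upwards [gt_mem_nhds ht] with r hr using hx0 r (le_of_lt hr)
      change deriv x t = 0
      rw [h6.deriv_eq, deriv_const]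
    rw [closure_Iio] at h5
    exact fun t ht => h5 ht
  have hint : ∀ t, ∫ s in (0 : ℝ)..t, deriv x s = x t := fun t => by
    rw [intervalIntegral.integral_deriv_eq_sub
      (fun s _ => (h2.differentiable one_ne_zero).differentiableAt) (hd.intervalIntegrable _ _),
      hx0 0 le_rfl, sub_zero]
  have hz : ∀ t ≤ T, integ (CausalSpace.truncate T (deriv x) hd hd0) t = x t := fun t ht => by
    rw [integ_apply _ ht]
    rcases le_total t 0 with h0 | h0
    · rw [primitive_nonpos (fun r hr => apply_nonpos _ hr) h0, hx0 t h0]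
    · rw [← hint t]
      refine intervalIntegral.integral_congr fun s hs => ?_
      rw [uIcc_of_le h0] at hs
      exact truncate_apply_of_le _ _ (hs.2.trans ht)
  refine ⟨CausalSpace.truncate T (deriv x) hd hd0, fun t ht => ?_, hz⟩
  rw [lowerOrder_apply_apply _ ht, hz t ht, truncate_apply_of_le _ _ ht,
    convAt_congr fun s hs => hz s (hs.trans ht), ← h4 t]
  refine IsSkewAdjoint.mem_graph_iff_graphSpace.2 ⟨u t, rfl, ?_⟩
  simp only [hx]
  abel

theorem IsGlobalSolution.eq_of_isSolutionUpTo (hP : IsSkewAdjoint P) (hw : w ∈ coerciveSet α)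
    {u : ℝ → GraphSpace P} (hu : IsGlobalSolution P α β F w u) {y : CausalSpace H T}
    (hy : IsSolutionUpTo P α β F w y) {t : ℝ} (ht : t ≤ T) :
    GraphSpace.incl P (u t) = integ y t := by
  obtain ⟨z, hz, hz'⟩ := hu.exists_isSolutionUpTo T
  rw [← hz' t ht, IsSolutionUpTo.unique hP hw hz hy]

theorem IsGlobalSolution.unique (hP : IsSkewAdjoint P) (hw : w ∈ coerciveSet α)
    {u u' : ℝ → GraphSpace P} (hu : IsGlobalSolution P α β F w u)
    (hu' : IsGlobalSolution P α β F w u') : u = u' := by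
  funext t
  obtain ⟨z, hz, hz'⟩ := hu'.exists_isSolutionUpTo t
  refine Subtype.ext ?_
  change GraphSpace.incl P (u t) = GraphSpace.incl P (u' t)
  rw [← hz' t le_rfl, hu.eq_of_isSolutionUpTo hP hw hz le_rfl]

/-- Solutions up to every finite time fit together. -/
theorem exists_isGlobalSolution (hP : IsSkewAdjoint P) (hw : w ∈ coerciveSet α) (hF : Continuous F)
    (h : ∀ T > 0, ∃ y : CausalSpace H T, IsSolutionUpTo P α β F w y) :
    ∃ u, IsGlobalSolution P α β F w u := by
  -- The horizon `n + 1` leaves room to the right of every `t ≤ n`, so near each `t` the glued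
  -- function agrees with a single `y n`.
  choose y hy using fun n : ℕ => h ((n : ℝ) + 1) (by positivity)
  have hmono : ∀ {m n : ℕ}, m ≤ n → ∀ t ≤ (m : ℝ) + 1, y m t = y n t := fun {m n} hmn t ht => by
    have h1 : (m : ℝ) + 1 ≤ n + 1 := by gcongr
    rw [IsSolutionUpTo.unique hP hw (hy m) ((hy n).truncate h1)]
    exact truncate_apply_of_le _ _ ht
  have hcomp : ∀ (m n : ℕ) (t : ℝ), t ≤ (m : ℝ) + 1 → t ≤ (n : ℝ) + 1 → y m t = y n t :=
    fun m n t hm hn => by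
      rcases le_total m n with h1 | h1
      · exact hmono h1 t hm
      · exact (hmono h1 t hn).symm
  let V : ℝ → H := fun t => y ⌈t⌉₊ t
  have hV : ∀ (n : ℕ), ∀ t ≤ (n : ℝ) + 1, V t = y n t := fun n t ht =>
    hcomp _ _ _ (by linarith [Nat.le_ceil t]) ht
  have hVc : Continuous V := by
    refine continuous_iff_continuousAt.2 fun t => ?_
    refine (y ⌈t⌉₊).continuous.continuousAt.congr ?_
    filter_upwards [gt_mem_nhds (show t < (⌈t⌉₊ : ℝ) + 1 by linarith [Nat.le_ceil t])] with s hs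
    exact (hV _ s (le_of_lt hs)).symm
  have hx : ∀ (n : ℕ), ∀ t ≤ (n : ℝ) + 1, prim V t = integ (y n) t := fun n t ht => by
    rw [integ_apply _ ht]
    refine intervalIntegral.integral_congr fun s hs => hV n s ?_
    have h0 : (0 : ℝ) ≤ n + 1 := by positivity
    exact hs.2.trans (max_le h0 ht)
  let Z : ℝ → H := fun t => F t - α w.1 (V t) -
    (β w.2.1 (prim V t) + convAt α w.2.2 (prim V) t)
  have hZ : ∀ (n : ℕ), ∀ t ≤ (n : ℝ) + 1,
      Z t = F t - α w.1 (y n t) - lowerOrder (n + 1) α β w (integ (y n)) t := fun n t ht => by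
    rw [lowerOrder_apply_apply _ ht, ← hV n t ht, ← hx n t ht,
      ← convAt_congr fun s hs => hx n s (hs.trans ht)]
  have hgraph : ∀ t, (prim V t, Z t) ∈ P.graph := fun t => by
    have h1 : t ≤ (⌈t⌉₊ : ℝ) + 1 := by linarith [Nat.le_ceil t]
    rw [hx _ t h1, hZ _ t h1]
    exact hy _ t h1
  have hZc : Continuous Z := by
    refine continuous_iff_continuousAt.2 fun t => ?_
    have h1 : Continuous fun s => F s - α w.1 (y ⌈t⌉₊ s) -
        lowerOrder (⌈t⌉₊ + 1) α β w (integ (y ⌈t⌉₊)) s :=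
      (hF.sub ((α w.1).continuous.comp (y _).continuous)).sub (CausalSpace.continuous _)
    refine h1.continuousAt.congr ?_
    filter_upwards [gt_mem_nhds (show t < (⌈t⌉₊ : ℝ) + 1 by linarith [Nat.le_ceil t])] with s hs
    exact (hZ _ s (le_of_lt hs)).symm
  have hd : ∀ t, HasDerivAt (prim V) (V t) t := fun t => hasDerivAt_primitive hVc t
  have hpc : Continuous (prim V) := continuous_primitive hVc
  -- Applying `(1 + P)⁻¹` to `u + P u` turns continuity of `u` and `P u` in `H` into continuity in
  -- the graph norm.
  obtain ⟨R, hR, -⟩ := hP.exists_graphSpace_resolvent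
  have hincl : ∀ t, GraphSpace.incl P (R (prim V t + Z t)) = prim V t := fun t =>
    (incl_op_eq_of_graph hR (hgraph t)).1
  have hop : ∀ t, GraphSpace.op P (R (prim V t + Z t)) = Z t := fun t =>
    (incl_op_eq_of_graph hR (hgraph t)).2
  refine ⟨fun t => R (prim V t + Z t), R.continuous.comp (hpc.add hZc), ?_, fun t ht => ?_,
    fun t => ?_⟩
  · simp only [hincl]
    rw [contDiff_one_iff_deriv]
    refine ⟨fun t => (hd t).differentiableAt, ?_⟩
    rwa [funext fun t => (hd t).deriv]
  · refine Subtype.ext ?_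
    change GraphSpace.incl P (R (prim V t + Z t)) = 0
    rw [hincl, hx 0 t (by linarith [Nat.cast_zero (R := ℝ)]), apply_nonpos _ ht.le]
  · simp only [hincl, hop]
    rw [(hd t).deriv]
    simp only [Z]
    abel

end Global

/-! ### The forward map -/

section Forward

variable {d k : ℕ} {Ω : Set (EuclideanSpace ℝ (Fin d))}

/-- Multiplication by symmetric matrices as a continuous bilinear map. -/
def mulSymmL (Ω : Set (EuclideanSpace ℝ (Fin d))) (k : ℕ) :
    LInfSymm Ω k →L[ℝ] State Ω k →L[ℝ] State Ω k :=
  ((matAct k).comp (symmMat k).subtypeL).holderL (vol Ω) ∞ 2 2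

/-- Multiplication by matrices as a continuous bilinear map. -/
def mulL (Ω : Set (EuclideanSpace ℝ (Fin d))) (k : ℕ) :
    LInfMat Ω k →L[ℝ] State Ω k →L[ℝ] State Ω k :=
  (matAct k).holderL (vol Ω) ∞ 2 2

theorem mulSymmL_apply (a : LInfSymm Ω k) (u : State Ω k) : mulSymmL Ω k a u = mulOpSymm a u := rfl

theorem inner_mulSymmL (a : LInfSymm Ω k) (u v : State Ω k) :
    ⟪mulSymmL Ω k a u, v⟫ = ⟪u, mulSymmL Ω k a v⟫ := by
  rw [mulSymmL_apply, mulSymmL_apply, L2.inner_def, L2.inner_def]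
  refine integral_congr_ae ?_
  filter_upwards [coeFn_mulOpSymm a u, coeFn_mulOpSymm a v] with x h1 h2
  have hs : (a x : Mat k).IsSymm := (a x).2
  rw [h1, h2]
  simp only [EuclideanSpace.inner_eq_star_dotProduct, star_trivial]
  rw [Matrix.dotProduct_mulVec, ← Matrix.mulVec_transpose, hs.eq, dotProduct_comm]

/-- The pointwise bound `a > c` integrates to coercivity on L². The calculus is carried out on the
larger set, which is open, and then restricted. -/
theorem admissible_subset : admissible Ω k ⊆ coerciveSet (mulSymmL Ω k) := by
  rintro w ⟨c, C, CB, CQ, hc, -, -, -, hw, -⟩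
  refine ⟨c, hc, fun u v => inner_mulSymmL _ _ _, fun u => ?_⟩
  rw [← real_inner_self_eq_norm_sq, mulSymmL_apply, L2.inner_def, L2.inner_def,
    ← integral_const_mul]
  refine integral_mono_ae ((L2.integrable_inner u u).const_mul c) (L2.integrable_inner _ _) ?_
  filter_upwards [hw, coeFn_mulOpSymm w.1 u] with x hx h1
  have h2 := hx.1.posSemidef.dotProduct_mulVec_nonneg (u x).ofLp
  simp only [h1, EuclideanSpace.inner_eq_star_dotProduct, star_trivial] at h2 ⊢
  rw [Matrix.sub_mulVec, Matrix.smul_mulVec, Matrix.one_mulVec, dotProduct_sub, dotProduct_smul,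
    smul_eq_mul, sub_nonneg] at h2
  exact h2

theorem isCausalSolution_iff {P : State Ω k →ₗ.[ℝ] State Ω k} {f F : ℝ → State Ω k}
    (hF : Continuous F) (hFf : f =ᵐ[volume] F) {w : Coeff Ω k} {u : ℝ → GraphSpace P} :
    IsCausalSolution P f w u ↔ IsGlobalSolution P (mulSymmL Ω k) (mulL Ω k) F w u := by
  constructor
  · rintro ⟨h1, h2, h3, g, hg, hgf, h4⟩
    have : g = F := (hg.ae_eq_iff_eq volume hF).1 (hgf.trans hFf)
    rw [this] at h4
    exact ⟨h1, h2, h3, h4⟩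
  · rintro ⟨h1, h2, h3, h4⟩
    exact ⟨h1, h2, h3, F, hF, hFf.symm, h4⟩

/-- Pointwise application of an operator, as a map into `C([0, T])`. -/
def evalL {H Y : Type*} [NormedAddCommGroup H] [NormedSpace ℝ H] [NormedAddCommGroup Y]
    [NormedSpace ℝ Y] (T : ℝ) (S : H →L[ℝ] Y) : CausalSpace H T →L[ℝ] C(Icc (0 : ℝ) T, Y) :=
  LinearMap.mkContinuous
    { toFun x := ⟨fun t => S (x t), S.continuous.comp (x.continuous.comp continuous_subtype_val)⟩
      map_add' x y := ContinuousMap.ext fun t => S.map_add _ _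
      map_smul' c x := ContinuousMap.ext fun t => S.map_smul c _ }
    ‖S‖ fun x => (ContinuousMap.norm_le _ (by positivity)).2 fun t =>
      S.le_opNorm_of_le (x.norm_apply_le _)

theorem contDiffOn_forwardMap_and_existsUnique {l n s : ℕ} {Γ : Set (EuclideanSpace ℝ (Fin d))}
    (hs : 2 ≤ s) (P : State Ω k →ₗ.[ℝ] State Ω k) (hP : IsSkewAdjoint P)
    (S : GraphSpace P →L[ℝ] Data n Γ l) (f : ℝ → State Ω k) (hf : MemHs s f)
    (hfc : ∀ᵐ t : ℝ, t < 0 → f t = 0) (T : ℝ) (hT : 0 < T) :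
    (∀ w ∈ admissible Ω k,
      (∃! u : ℝ → GraphSpace P, IsCausalSolution P f w u) ∧
      ∀ u : ℝ → GraphSpace P, IsCausalSolution P f w u →
        ∀ t : Icc (0 : ℝ) T, forwardMap P S f T w t = S (u t)) ∧
    ContDiffOn ℝ ((s - 1 : ℕ) : WithTop ℕ∞) (forwardMap P S f T) (admissible Ω k) := by
  -- Of the `j + 2` primitives, the first makes the continuous `φ = prim g`; the other `j + 1` are
  -- powers of `integ` and give class C^(j + 1).
  obtain ⟨j, rfl⟩ := Nat.exists_eq_add_of_le' hs
  obtain ⟨g, hg, hg0, hfg⟩ := hf.exists_prim hfc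
  set F : ℝ → State Ω k := prim^[j + 2] g with hF
  have hφ0 : ∀ t ≤ 0, prim g t = 0 := fun t ht => prim_nonpos hg0 ht
  have hFi : ∀ T : ℝ, ∀ t ≤ T,
      (integ ^ (j + 1)) (truncate T (prim g) (continuous_prim hg) hφ0) t = F t := fun T t ht => by
    rw [integ_pow_truncate_apply _ _ _ t ht, hF, ← Function.iterate_succ_apply]
  have hFc : Continuous F := by
    refine continuous_iff_continuousAt.2 fun t => ?_
    refine ((integ ^ (j + 1)) (truncate (t + 1) (prim g) (continuous_prim hg)
      hφ0)).continuous.continuousAt.congr ?_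
    filter_upwards [gt_mem_nhds (lt_add_one t)] with r hr using hFi _ r (le_of_lt hr)
  have hsol : ∀ T > 0, ∃ y : Coeff Ω k → CausalSpace (State Ω k) T,
      ContDiffOn ℝ ((j + 1 : ℕ) : WithTop ℕ∞) y (coerciveSet (mulSymmL Ω k)) ∧
      ∀ w ∈ coerciveSet (mulSymmL Ω k),
        IsSolutionUpTo P (mulSymmL Ω k) (mulL Ω k) F w (y w) := fun T hT => by
    obtain ⟨h, hh, hφ⟩ := exists_approximation hT hg hg0
    obtain ⟨y, hy, hy'⟩ := exists_solution_contDiffOn (α := mulSymmL Ω k) (β := mulL Ω k) hT.le hP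
      inner_mulSymmL hh hφ j
    refine ⟨y, hy, fun w hw t ht => ?_⟩
    rw [← hFi T t ht]
    exact hy' w hw t
  have hiff : ∀ (w : Coeff Ω k) (u : ℝ → GraphSpace P), IsCausalSolution P f w u ↔
      IsGlobalSolution P (mulSymmL Ω k) (mulL Ω k) F w u := fun w u => isCausalSolution_iff hFc hfg
  have hex : ∀ w ∈ coerciveSet (mulSymmL Ω k), ∃ u, IsCausalSolution P f w u := fun w hw => by
    obtain ⟨u, hu⟩ := exists_isGlobalSolution (β := mulL Ω k) hP hw hFc fun T hT => by
      obtain ⟨y, -, hy⟩ := hsol T hT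
      exact ⟨y w, hy w hw⟩
    exact ⟨u, (hiff w u).2 hu⟩
  have huniq : ∀ w ∈ coerciveSet (mulSymmL Ω k), ∀ u u', IsCausalSolution P f w u →
      IsCausalSolution P f w u' → u = u' := fun w hw u u' hu hu' =>
    IsGlobalSolution.unique hP hw ((hiff w u).1 hu) ((hiff w u').1 hu')
  have hfor : ∀ w ∈ coerciveSet (mulSymmL Ω k), ∀ u, IsCausalSolution P f w u →
      ∀ t : Icc (0 : ℝ) T, forwardMap P S f T w t = S (u t) := fun w hw u hu t => by
    have h := hex w hw
    rw [forwardMap, dif_pos h, huniq w hw u _ hu h.choose_spec]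
    rfl
  refine ⟨fun w hw => ⟨?_, hfor w (admissible_subset hw)⟩, ?_⟩
  · obtain ⟨u, hu⟩ := hex w (admissible_subset hw)
    exact ⟨u, hu, fun u' hu' => huniq w (admissible_subset hw) u' u hu' hu⟩
  obtain ⟨y, hyc, hy⟩ := hsol T hT
  obtain ⟨R, hR, -⟩ := hP.exists_graphSpace_resolvent
  -- Here `P u` is eliminated by the equation, `P u = F - fullOp w y` with `y = u'`, so that `S u =
  -- S R (u + P u)` involves only the bounded operator `S R` on `H` and quantities known to be
  -- smooth in `w`.
  have hformula : ∀ w ∈ admissible Ω k, forwardMap P S f T w = evalL T (S ∘L R)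
      ((integ ^ (j + 1)) (truncate T (prim g) (continuous_prim hg) hφ0) + integ (y w) -
        fullOp T (mulSymmL Ω k) (mulL Ω k) w (y w)) := fun w hw => by
    have hw' := admissible_subset hw
    obtain ⟨u, hu⟩ := hex w hw'
    ext1 t
    rw [hfor w hw' u hu t]
    change _ = S (R (_ : State Ω k))
    congr 1
    have h1 := ((hiff w u).1 hu).eq_of_isSolutionUpTo hP hw' (hy w hw') t.2.2
    have h2 := (incl_op_eq_of_graph hR (hy w hw' t t.2.2)).1
    refine Subtype.ext ?_
    change GraphSpace.incl P (u t) = GraphSpace.incl P (R _)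
    rw [h1]
    refine h2.symm.trans ?_
    congr 2
    rw [CausalSpace.sub_apply, CausalSpace.add_apply, fullOp_apply, CausalSpace.add_apply,
      lift_apply, hFi T t t.2.2]
    rw [add_comm (F t), add_sub_assoc, ← sub_sub]
  have hsm : ContDiffOn ℝ ((j + 1 : ℕ) : WithTop ℕ∞) (fun w => evalL T (S ∘L R)
      ((integ ^ (j + 1)) (truncate T (prim g) (continuous_prim hg) hφ0) + integ (y w) -
        fullOp T (mulSymmL Ω k) (mulL Ω k) w (y w))) (admissible Ω k) := by
    have hy1 := hyc.mono admissible_subset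
    refine (evalL T (S ∘L R)).contDiff.comp_contDiffOn ?_
    refine (contDiffOn_const.add (integ.contDiff.comp_contDiffOn hy1)).sub ?_
    exact (fullOp T (mulSymmL Ω k) (mulL Ω k)).contDiff.contDiffOn.clm_apply hy1
  exact hsm.congr hformula

end Forward

end SymmHyp

end

theorem theorem2 {d k l n s : ℕ} (hn : n < d) (hs : 2 ≤ s)
    {Ω Γ : Set (EuclideanSpace ℝ (Fin d))} (hΩ : MeasurableSet Ω)
    (p : Fin d → SymmHyp.Mat k) (hp : ∀ j, (p j).IsSymm)
    (P : SymmHyp.State Ω k →ₗ.[ℝ] SymmHyp.State Ω k)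
    (hP : SymmHyp.IsSkewAdjoint P) (hpP : SymmHyp.Extends P p)
    (hΓ : SymmHyp.IsSmoothSubmanifold n Γ) (hΓΩ : Γ ⊆ Ω)
    (m : EuclideanSpace ℝ (Fin d) → Matrix (Fin l) (Fin k) ℝ) (hm : SymmHyp.IsMultiplier Γ m)
    (S : SymmHyp.GraphSpace P →L[ℝ] SymmHyp.Data n Γ l) (hS : SymmHyp.ExtendsTrace m S)
    (f : ℝ → SymmHyp.State Ω k) (hf : SymmHyp.MemHs s f)
    (hfc : ∀ᵐ t : ℝ, t < 0 → f t = 0) (T : ℝ) (hT : 0 < T) :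
    (∀ w ∈ SymmHyp.admissible Ω k,
      (∃! u : ℝ → SymmHyp.GraphSpace P, SymmHyp.IsCausalSolution P f w u) ∧
      ∀ u : ℝ → SymmHyp.GraphSpace P, SymmHyp.IsCausalSolution P f w u →
        ∀ t : Icc (0 : ℝ) T, SymmHyp.forwardMap P S f T w t = S (u t)) ∧
    ContDiffOn ℝ ((s - 1 : ℕ) : WithTop ℕ∞) (SymmHyp.forwardMap P S f T)
      (SymmHyp.admissible Ω k) :=
  SymmHyp.contDiffOn_forwardMap_and_existsUnique hs P hP S f hf hfc T hT
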